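/- Let $d\in\mathbb N$, $\mathbb T^d=(\mathbb R/2\pi\mathbb Z)^d$, $\varphi_k(x)=(2\pi)^{-d/2}e^{ikx}$ and $\lambda_k=|k|^2$ for $k\in\mathbb Z^d$. All function spaces consist of real-valued functions; $H^1(\mathbb T^d)=\{w\in L^2(\mathbb T^d):\sum_k\lambda_k|\langle w,\varphi_k\rangle|^2<\infty\}$ with $\|w\|_{H^1}^2=\|w\|_{L^2}^2+\sum_k\lambda_k|\langle w,\varphi_k\rangle|^2$, and $H^1\times L^2(\mathbb T^d)$ carries the norm $\|(w,v)\|^2=\|w\|_{H^1}^2+\|v\|_{L^2}^2$. Consider the bilinear wave equation $$\partial_t^2 w(x,t)=\Big(\Delta+\sum_{j=0}^{2d}p_j(t)\mu_j(x)\Big)w(x,t),\qquad (\mu_0,\dots,\mu_{2d})=(1,\cos x_1,\sin x_1,\dots,\cos x_d,\sin x_d),$$ with control $p=(p_0,\dots,p_{2d})$. For a piecewise constant $p:[0,\tau]\to\mathbb R^{2d+1}$, a solution on $[0,\tau]$ with initial state $W_0=(w_0,\dot w_0)$ is a function $W=(w,\partial_t w)\in C^0([0,\tau],H^1\times L^2(\mathbb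 T^d))$ such that, for all $t\in[0,\tau]$, $$W(t)=e^{t\mathcal A}W_0+\int_0^t e^{(t-s)\mathcal A}\Big(\sum_{j=0}^{2d}p_j(s)\mu_j\,\mathcal B\Big)W(s)\,ds,\qquad \mathcal A=\begin{pmatrix}0&I\\ \Delta&0\end{pmatrix},\quad \mathcal B=\begin{pmatrix}0&0\\ I&0\end{pmatrix},$$ where $e^{t\mathcal A}$ is the free wave evolution, given by its Fourier series. **Proposition.** Let $(w_0,\dot w_0)\in H^1\times L^2(\mathbb T^d)$ be such that $w_0\neq0$ and $\langle w_0,e^{ikx}\rangle_{L^2}=0$ for all but finitely many $k\in\mathbb Z^d$, and let $f\in L^2(\mathbb T^d)$. Then for all $\varepsilon,T>0$ there exist a time $\tau\in[0,T)$ and a piecewise constant control $p:[0,\tau]\to\mathbb R^{2d+1}$ such that a solution on $[0,\tau]$ with initial state $(w_0,\dot w_0)$ and control $p$ exists, and every such solution satisfies $$\Big\|\big(w(\cdot,\tau),\partial_t w(\cdot,\tau)\big)-(w_0,f)\Big\|_{H^1\times L^2(\mathbb T^d)}<\varepsilon .$$ -/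

import Mathlib

open MeasureTheory Set Filter Topology
open scoped Real ENNReal BigOperators

namespace BilinearWave

noncomputable section

/-! ### The torus, its Fourier modes, and `L²` -/

instance instFactTwoPi : Fact (0 < 2 * π) := ⟨Real.two_pi_pos⟩

/-- The `d`-dimensional torus `(ℝ / 2πℤ)^d`; its `volume` is the product of the Lebesgue measures of
the factors, so that the total mass is `(2π)^d`. -/
abbrev Torus (d : ℕ) : Type := Fin d → AddCircle (2 * π)

/-- The function `x ↦ e^{ikx}` on the torus, for `k ∈ ℤ^d`. -/
def expMode {d : ℕ} (k : Fin d → ℤ) : C(Torus d, ℂ) where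
  toFun x := ∏ i, fourier (k i) (x i)
  continuous_toFun := by fun_prop

/-- The `L²`-normalised eigenfunction `φ_k(x) = (2π)^{-d/2} e^{ikx}` of `-Δ`. -/
def phi {d : ℕ} (k : Fin d → ℤ) : C(Torus d, ℂ) :=
  (((2 * π) ^ (-(d : ℝ) / 2) : ℝ) : ℂ) • expMode k

/-- The eigenvalue `λ_k = |k|²` of `-Δ`. -/
def eigen {d : ℕ} (k : Fin d → ℤ) : ℝ := ∑ i, (k i : ℝ) ^ 2

/-- Real-valued square integrable functions on the torus. -/
abbrev L2 (d : ℕ) : Type := Lp ℝ 2 (volume : Measure (Torus d))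

/-- The Fourier coefficient `⟨w, φ_k⟩ = ∫ w \overline{φ_k}`. -/
def coeff {d : ℕ} (w : L2 d) (k : Fin d → ℤ) : ℂ :=
  ∫ x, ((w x : ℝ) : ℂ) * (starRingEnd ℂ) (phi k x)

theorem eigen_nonneg {d : ℕ} (k : Fin d → ℤ) : 0 ≤ eigen k :=
  Finset.sum_nonneg fun _ _ => sq_nonneg _

theorem integrable_mul_mode {d : ℕ} (w : L2 d) (k : Fin d → ℤ) :
    Integrable (fun x => ((w x : ℝ) : ℂ) * (starRingEnd ℂ) (phi k x)) := by
  have h1 : Integrable (fun x => ((w x : ℝ) : ℂ)) :=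
    ((Lp.memLp w).integrable (by norm_num)).ofReal
  refine h1.mul_bdd (c := ‖phi k‖) ?_ ?_
  · exact (Complex.continuous_conj.comp (phi k).continuous).aestronglyMeasurable
  · refine Eventually.of_forall fun x => ?_
    rw [RCLike.norm_conj]
    exact (phi k).norm_coe_le_norm x

theorem coeff_add {d : ℕ} (v w : L2 d) (k : Fin d → ℤ) :
    coeff (v + w) k = coeff v k + coeff w k := by
  unfold coeff
  rw [← integral_add (integrable_mul_mode v k) (integrable_mul_mode w k)]
  refine integral_congr_ae ?_
  filter_upwards [Lp.coeFn_add v w] with x hx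
  rw [hx]
  simp [add_mul]

theorem coeff_smul {d : ℕ} (c : ℝ) (w : L2 d) (k : Fin d → ℤ) :
    coeff (c • w) k = c • coeff w k := by
  unfold coeff
  rw [← integral_smul]
  refine integral_congr_ae ?_
  filter_upwards [Lp.coeFn_smul c w] with x hx
  rw [hx]
  simp [mul_assoc]

/-! ### The Sobolev space `H¹` -/

/-- The weighted coefficient family `k ↦ √λ_k ⟨w, φ_k⟩`, depending linearly on `w`. -/
def gradCoeff (d : ℕ) : L2 d →ₗ[ℝ] ((Fin d → ℤ) → ℂ) where
  toFun w k := Real.sqrt (eigen k) • coeff w k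
  map_add' v w := by
    funext k
    simp [coeff_add]
  map_smul' c w := by
    funext k
    simp only [coeff_smul, RingHom.id_apply, Pi.smul_apply]
    rw [smul_comm]

theorem memlp_gradCoeff_iff {d : ℕ} (w : L2 d) :
    Memℓp (gradCoeff d w) 2 ↔ Summable fun k => eigen k * ‖coeff w k‖ ^ 2 := by
  rw [memℓp_gen_iff (by norm_num)]
  refine summable_congr fun k => ?_
  simp [gradCoeff, mul_pow, Real.sq_sqrt (eigen_nonneg k)]

/-- `H¹` as a linear subspace of `L²`: the functions with `∑ λ_k |⟨w, φ_k⟩|² < ∞`. -/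
def H1sub (d : ℕ) : Submodule ℝ (L2 d) where
  carrier := {w | Summable fun k => eigen k * ‖coeff w k‖ ^ 2}
  add_mem' := by
    intro v w hv hw
    simp only [mem_ofPred_eq, ← memlp_gradCoeff_iff] at hv hw ⊢
    rw [map_add]
    exact hv.add hw
  zero_mem' := by
    simp only [mem_ofPred_eq, ← memlp_gradCoeff_iff, map_zero]
    exact zero_memℓp
  smul_mem' := by
    intro c w hw
    simp only [mem_ofPred_eq, ← memlp_gradCoeff_iff] at hw ⊢
    rw [map_smul]
    exact hw.const_smul c

/-- The Sobolev space `H¹` of real-valued functions, with its own norm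
`‖w‖² = ‖w‖²_{L²} + ∑ λ_k |⟨w, φ_k⟩|²` (it is a separate type because, as a subspace of `L²`,
`H1sub` already carries the `L²` norm). -/
def H1 (d : ℕ) : Type := H1sub d

instance instAddCommGroupH1 (d : ℕ) : AddCommGroup (H1 d) :=
  inferInstanceAs (AddCommGroup (H1sub d))

instance instModuleH1 (d : ℕ) : Module ℝ (H1 d) :=
  inferInstanceAs (Module ℝ (H1sub d))

/-- The inclusion `H¹ → L²`. -/
def H1.incl (d : ℕ) : H1 d →ₗ[ℝ] L2 d := (H1sub d).subtype

/-- An `L²` function satisfying the summability condition, as an element of `H¹`. -/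
def H1.mk {d : ℕ} (w : L2 d) (hw : Summable fun k => eigen k * ‖coeff w k‖ ^ 2) : H1 d :=
  (⟨w, hw⟩ : H1sub d)

theorem H1.incl_injective (d : ℕ) : Function.Injective (H1.incl d) :=
  (H1sub d).injective_subtype

theorem H1.memlp {d : ℕ} (w : H1 d) : Memℓp (gradCoeff d (H1.incl d w)) 2 :=
  (memlp_gradCoeff_iff _).2 w.2

/-- The map `w ↦ (w, (√λ_k ⟨w, φ_k⟩)_k)` into the Hilbert space `L² ⊕ ℓ²`, whose norm `H¹` carries. -/
def H1.embed (d : ℕ) : H1 d →ₗ[ℝ] WithLp 2 (L2 d × lp (fun _ : Fin d → ℤ => ℂ) 2) where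
  toFun w := WithLp.toLp 2 (H1.incl d w, ⟨gradCoeff d (H1.incl d w), H1.memlp w⟩)
  map_add' v w := by
    rw [← WithLp.toLp_add]
    congr 1
    exact Prod.ext (map_add _ v w) (Subtype.ext
      ((congrArg (gradCoeff d) (map_add (H1.incl d) v w)).trans (map_add (gradCoeff d) _ _)))
  map_smul' c w := by
    rw [RingHom.id_apply, ← WithLp.toLp_smul]
    congr 1
    exact Prod.ext (map_smul _ c w) (Subtype.ext
      ((congrArg (gradCoeff d) (map_smul (H1.incl d) c w)).trans (map_smul (gradCoeff d) _ _)))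

theorem H1.embed_injective (d : ℕ) : Function.Injective (H1.embed d) := fun _ _ h =>
  H1.incl_injective d (congrArg (fun z => (WithLp.ofLp z).1) h)

instance instNormedAddCommGroupH1 (d : ℕ) : NormedAddCommGroup (H1 d) :=
  NormedAddCommGroup.induced (H1 d) _ (H1.embed d) (H1.embed_injective d)

instance instNormedSpaceH1 (d : ℕ) : NormedSpace ℝ (H1 d) :=
  NormedSpace.induced ℝ (H1 d) _ (H1.embed d)

theorem H1.norm_sq {d : ℕ} (w : H1 d) :
    ‖w‖ ^ 2 = ‖H1.incl d w‖ ^ 2 + ∑' k, eigen k * ‖coeff (H1.incl d w) k‖ ^ 2 := by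
  have h0 : ‖w‖ = ‖H1.embed d w‖ := rfl
  rw [h0, WithLp.prod_norm_sq_eq_of_L2]
  congr 1
  have h := lp.norm_rpow_eq_tsum (p := 2) (by norm_num)
    (⟨gradCoeff d (H1.incl d w), H1.memlp w⟩ : lp (fun _ : Fin d → ℤ => ℂ) 2)
  simp only [ENNReal.toReal_ofNat, Real.rpow_ofNat] at h
  refine h.trans (tsum_congr fun k => ?_)
  simp [gradCoeff, mul_pow, Real.sq_sqrt (eigen_nonneg k)]

/-! ### Fourier components of real functions -/

theorem integral_expMode {d : ℕ} {k : Fin d → ℤ} (hk : k ≠ 0) : ∫ x, expMode k x = 0 := by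
  obtain ⟨i, hi⟩ := Function.ne_iff.mp hk
  have h1 : ∫ x, expMode k x = ∏ i, ∫ y : AddCircle (2 * π), fourier (k i) y :=
    integral_fintype_prod_volume_eq_prod (fun i (y : AddCircle (2 * π)) => fourier (k i) y)
  rw [h1]
  refine Finset.prod_eq_zero (Finset.mem_univ i) ?_
  exact integral_eq_zero_of_add_right_eq_neg
    (fourier_add_half_inv_index hi Real.two_pi_pos)

theorem expMode_mul_conj {d : ℕ} (k j : Fin d → ℤ) (x : Torus d) :
    expMode k x * (starRingEnd ℂ) (expMode j x) = expMode (k - j) x := by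
  simp only [expMode, ContinuousMap.coe_mk, map_prod, ← Finset.prod_mul_distrib]
  refine Finset.prod_congr rfl fun i _ => ?_
  rw [← fourier_neg, ← fourier_add, Pi.sub_apply, sub_eq_add_neg]

theorem conj_expMode {d : ℕ} (k : Fin d → ℤ) (x : Torus d) :
    (starRingEnd ℂ) (expMode k x) = expMode (-k) x := by
  simp only [expMode, ContinuousMap.coe_mk, map_prod, Pi.neg_apply, fourier_neg]

/-- The real function `Re (⟨w, φ_k⟩ φ_k)`, as an element of `L²`. As `w` is real, for every real
multiplier with `m_{-k} = m_k` one has `∑ m_k ⟨w, φ_k⟩ φ_k = ∑ m_k Re (⟨w, φ_k⟩ φ_k)`. -/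
def part {d : ℕ} (w : L2 d) (k : Fin d → ℤ) : L2 d :=
  ContinuousMap.toLp 2 volume ℝ
    (⟨fun x => (coeff w k * phi k x).re, by fun_prop⟩ : C(Torus d, ℝ))

theorem coeff_part_eq_zero {d : ℕ} (w : L2 d) {k j : Fin d → ℤ} (h1 : k ≠ j) (h2 : -k ≠ j) :
    coeff (part w k) j = 0 := by
  set r : ℂ := (((2 * π) ^ (-(d : ℝ) / 2) : ℝ) : ℂ) with hr
  have key : ∀ x : Torus d,
      (((coeff w k * phi k x).re : ℝ) : ℂ) * (starRingEnd ℂ) (phi j x)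
        = coeff w k * r * r / 2 * expMode (k - j) x
          + (starRingEnd ℂ) (coeff w k) * r * r / 2 * expMode (-k - j) x := by
    intro x
    have hp : ∀ i : Fin d → ℤ, phi i x = r * expMode i x := fun i => rfl
    have hrr : (starRingEnd ℂ) r = r := Complex.conj_ofReal _
    rw [Complex.re_eq_add_conj, hp, hp, map_mul, map_mul, map_mul, hrr, conj_expMode k,
      ← expMode_mul_conj, ← expMode_mul_conj]
    ring
  have hc : coeff (part w k) j
      = ∫ x, (((coeff w k * phi k x).re : ℝ) : ℂ) * (starRingEnd ℂ) (phi j x) := by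
    refine integral_congr_ae ?_
    filter_upwards [ContinuousMap.coeFn_toLp (p := 2) (𝕜 := ℝ) (volume : Measure (Torus d))
      (⟨fun x => (coeff w k * phi k x).re, by fun_prop⟩ : C(Torus d, ℝ))] with x hx
    rw [part, hx]
    rfl
  have hint : ∀ i : Fin d → ℤ, Integrable (fun x : Torus d => expMode i x) := fun i =>
    (expMode i).continuous.integrable_of_hasCompactSupport (HasCompactSupport.of_compactSpace _)
  rw [hc, integral_congr_ae (Eventually.of_forall key),
    integral_add ((hint _).const_mul _) ((hint _).const_mul _), integral_const_mul,
    integral_const_mul, integral_expMode (sub_ne_zero.2 h1), integral_expMode (sub_ne_zero.2 h2)]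
  simp

theorem summable_part {d : ℕ} (w : L2 d) (k : Fin d → ℤ) :
    Summable fun j => eigen j * ‖coeff (part w k) j‖ ^ 2 := by
  refine summable_of_ne_finset_zero (s := {k, -k}) fun j hj => ?_
  simp only [Finset.mem_insert, Finset.mem_singleton, not_or] at hj
  rw [coeff_part_eq_zero w (Ne.symm hj.1) (Ne.symm hj.2)]
  simp

/-- The real function `Re (⟨w, φ_k⟩ φ_k)`, as an element of `H¹`. -/
def partH1 {d : ℕ} (w : L2 d) (k : Fin d → ℤ) : H1 d := H1.mk (part w k) (summable_part w k)

/-! ### The free evolution -/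

/-- The function `sin(√λ_k t) / √λ_k`, with the value `t` for `k = 0`. -/
def sinc {d : ℕ} (t : ℝ) (k : Fin d → ℤ) : ℝ :=
  if k = 0 then t else Real.sin (√(eigen k) * t) / √(eigen k)

/-- The free evolution `e^{tA}(w, v)`, `A = (0, I; Δ, 0)`, given by the Fourier series of the
solution of the wave equation: the profile is summed in `H¹` and the velocity in `L²`. -/
def freeFlow {d : ℕ} (t : ℝ) (W : H1 d × L2 d) : H1 d × L2 d :=
  (∑' k : Fin d → ℤ,
      (Real.cos (√(eigen k) * t) • partH1 (H1.incl d W.1) k + sinc t k • partH1 W.2 k),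
    ∑' k : Fin d → ℤ,
      (-(√(eigen k) * Real.sin (√(eigen k) * t)) • part (H1.incl d W.1) k
        + Real.cos (√(eigen k) * t) • part W.2 k))

/-! ### The controlled wave equation -/

/-- The spatial control functions `(μ_0, …, μ_{2d}) = (1, cos x_1, sin x_1, …, cos x_d, sin x_d)`:
for `i : Fin d`, the entries `2i + 1` and `2i + 2` are the real and the imaginary part of the `i`-th
coordinate function `e^{i x}`. -/
def lowMode (d : ℕ) (j : Fin (2 * d + 1)) : C(Torus d, ℝ) :=
  if hj : j.val = 0 then 1
  else if j.val % 2 = 1 then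
    ⟨fun x => (fourier 1 (x ⟨(j.val - 1) / 2, by omega⟩) : ℂ).re, by fun_prop⟩
  else
    ⟨fun x => (fourier 1 (x ⟨(j.val - 1) / 2, by omega⟩) : ℂ).im, by fun_prop⟩

/-- The potential `∑ p_j μ_j` of a control value `p ∈ ℝ^{2d+1}`. -/
def potential {d : ℕ} (p : Fin (2 * d + 1) → ℝ) : C(Torus d, ℝ) := ∑ j, p j • lowMode d j

theorem memLp_mul {d : ℕ} (m : C(Torus d, ℝ)) (w : L2 d) :
    MemLp (fun x => m x * w x) 2 (volume : Measure (Torus d)) := by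
  refine MemLp.of_le_mul (c := ‖m‖) (Lp.memLp w)
    (m.continuous.aestronglyMeasurable.mul (Lp.aestronglyMeasurable w))
    (Eventually.of_forall fun x => ?_)
  rw [norm_mul]
  gcongr
  exact m.norm_coe_le_norm x

/-- Multiplication of an `L²` function by a continuous function. -/
def mulL2 {d : ℕ} (m : C(Torus d, ℝ)) (w : L2 d) : L2 d := (memLp_mul m w).toLp _

/-- The control operator `(∑ p_j μ_j) B`, with `B (w, v) = (0, w)`. -/
def controlOp {d : ℕ} (p : Fin (2 * d + 1) → ℝ) (W : H1 d × L2 d) : H1 d × L2 d :=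
  (0, mulL2 (potential p) (H1.incl d W.1))

/-- `W` is a weak (mild) solution on `[0, τ]` of
`∂_t W = (A + ∑ p_j(t) μ_j B) W`, `W(0) = W₀`: a continuous curve in `H¹ × L²` with
`W(t) = e^{tA} W₀ + ∫_0^t e^{(t-s)A} (∑ p_j(s) μ_j B) W(s) ds` in `H¹ × L²` for all `t ∈ [0, τ]`.
Its components are the profile `w` and the velocity `∂_t w` of the wave with
`∂_t² w = (Δ + ∑ p_j(t) μ_j) w`. -/
structure IsWeakSolution {d : ℕ} (τ : ℝ) (p : ℝ → Fin (2 * d + 1) → ℝ) (W₀ : H1 d × L2 d)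
    (W : ℝ → H1 d × L2 d) : Prop where
  continuousOn : ContinuousOn W (Icc 0 τ)
  integrable : ∀ t ∈ Icc 0 τ,
    IntervalIntegrable (fun s => freeFlow (t - s) (controlOp (p s) (W s))) volume 0 t
  duhamel : ∀ t ∈ Icc 0 τ,
    W t = freeFlow t W₀ + ∫ s in (0 : ℝ)..t, freeFlow (t - s) (controlOp (p s) (W s))

/-- `p` is piecewise constant on `[0, τ]`: there is a finite subdivision `0 = t_0 < … < t_N = τ`
such that `p` is constant on every open interval `(t_i, t_{i+1})`. -/
def IsPiecewiseConstant {E : Type*} (τ : ℝ) (p : ℝ → E) : Prop :=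
  ∃ (N : ℕ) (t : Fin (N + 1) → ℝ), StrictMono t ∧ t 0 = 0 ∧ t (Fin.last N) = τ ∧
    ∀ i : Fin N, ∃ c : E, ∀ s ∈ Ioo (t i.castSucc) (t i.succ), p s = c

end

end BilinearWave

/-!
Let `S` be the free evolution and `K_m (w, v) = (0, m w)` for a multiplier `m`. Applying the
constant control `δ⁻¹ m` for the short time `δ` moves `(w, v)` close to `(w, v + m w)`, provided
that `m` is a combination of the `μ_j`: an impulse. Conjugating the free evolution by two opposite
large impulses gives a new one, because
`(1 - r⁻¹ K_m) S(r²) (1 + r⁻¹ K_m) → 1 - K_{m²}` strongly as `r → 0`. So the smooth multipliers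
available as impulses, which include the `μ_j`, contain `-m²` whenever they contain the multiples
of `m`. Polarization and the trigonometric addition formulas then make every trigonometric
polynomial available, and, by density, every continuous multiplier. A nonzero trigonometric
polynomial `w₀` vanishes only on a null set, so the products `m w₀` with `m` continuous are dense
in `L²`, and a single impulse moves the velocity close to `f` while the profile stays close to `w₀`.
-/

namespace BilinearWave

noncomputable section

/-! ### Mild solutions -/

theorem le_mul_exp_of_le_add_mul_integral {f : ℝ → ℝ} {τ a k : ℝ} (hk : 0 ≤ k)
    (hf : ContinuousOn f (Icc 0 τ)) (h : ∀ t ∈ Icc 0 τ, f t ≤ a + k * ∫ s in (0 : ℝ)..t, f s) :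
    ∀ t ∈ Icc 0 τ, f t ≤ a * Real.exp (k * t) := by
  intro t ht
  have hτ : 0 ≤ τ := ht.1.trans ht.2
  set g : ℝ → ℝ := IccExtend hτ ((Icc 0 τ).domRestrict f)
  have hg : Continuous g := (continuousOn_iff_continuous_domRestrict.1 hf).Icc_extend'
  have hgf : ∀ s ∈ Icc 0 τ, g s = f s := fun s hs => IccExtend_of_mem hτ _ hs
  set u : ℝ → ℝ := fun t => a + k * ∫ s in (0 : ℝ)..t, g s
  have hu : ∀ t, HasDerivAt u (k * g t) t := fun t =>
    ((hg.integral_hasStrictDerivAt 0 t).hasDerivAt.const_mul k).const_add a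
  have hgu : ∀ t ∈ Icc 0 τ, g t ≤ u t := by
    intro t ht
    rw [hgf t ht]
    refine (h t ht).trans_eq ?_
    congr 2
    refine intervalIntegral.integral_congr fun s hs => ?_
    rw [uIcc_of_le ht.1] at hs
    exact (hgf s ⟨hs.1, hs.2.trans ht.2⟩).symm
  have hbound := le_gronwallBound_of_liminf_deriv_right_le (δ := a) (K := k) (ε := 0)
    (fun t _ => (hu t).continuousAt.continuousWithinAt)
    (fun t _ _ hr => (hu t).hasDerivWithinAt.liminf_right_slope_le hr) (by simp [u])
    (fun t ht => by simpa using mul_le_mul_of_nonneg_left (hgu t ⟨ht.1, ht.2.le⟩) hk) t ht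
  rw [gronwallBound_ε0, sub_zero] at hbound
  exact (hgf t ht).symm.trans_le ((hgu t ht).trans hbound)

/-- A strongly continuous group of bounded operators. -/
structure IsStrongGroup {X : Type*} [NormedAddCommGroup X] [NormedSpace ℝ X]
    (S : ℝ → X →L[ℝ] X) : Prop where
  zero : ∀ x, S 0 x = x
  add : ∀ s t x, S (s + t) x = S s (S t x)
  continuous : Continuous fun q : ℝ × X => S q.1 q.2

/-- Mild solutions on `[0, τ]` of `W' = (A + K(t)) W`, `W(0) = W₀`, where `A` is the generator
of `S`. -/
structure IsMild {X : Type*} [NormedAddCommGroup X] [NormedSpace ℝ X]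
    (S : ℝ → X →L[ℝ] X) (τ : ℝ) (K : ℝ → X →L[ℝ] X) (W₀ : X) (W : ℝ → X) : Prop where
  continuousOn : ContinuousOn W (Icc 0 τ)
  integrable : ∀ t ∈ Icc 0 τ,
    IntervalIntegrable (fun s => S (t - s) (K s (W s))) volume 0 t
  duhamel : ∀ t ∈ Icc 0 τ, W t = S t W₀ + ∫ s in (0 : ℝ)..t, S (t - s) (K s (W s))

section Mild

variable {X : Type*} [NormedAddCommGroup X] [NormedSpace ℝ X] {S : ℝ → X →L[ℝ] X}

namespace IsStrongGroup

theorem of_tendsto {b : ℝ → ℝ} (hb : Continuous b) (norm_le : ∀ t, ‖S t‖ ≤ b t)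
    (add : ∀ s t x, S (s + t) x = S s (S t x))
    (tendsto : ∀ x, Tendsto (fun t => S t x) (𝓝 0) (𝓝 x)) : IsStrongGroup S where
  zero x := (tendsto_nhds_unique (tendsto_pure_nhds (fun t => S t x) 0)
    ((tendsto x).mono_left (pure_le_nhds 0)))
  add := add
  continuous := by
    refine continuous_iff_continuousAt.2 fun ⟨t₀, x₀⟩ => ?_
    rw [ContinuousAt, ← tendsto_sub_nhds_zero_iff]
    have hstate : Tendsto (fun q : ℝ × X => S q.1 (q.2 - x₀)) (𝓝 (t₀, x₀)) (𝓝 0) := by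
      refine squeeze_zero_norm (fun q => (S q.1).le_of_opNorm_le (norm_le q.1) _) ?_
      have hc : Continuous fun q : ℝ × X => b q.1 * ‖q.2 - x₀‖ := by fun_prop
      simpa using hc.tendsto (t₀, x₀)
    have htime : Tendsto (fun q : ℝ × X => S t₀ (S (q.1 - t₀) x₀ - x₀)) (𝓝 (t₀, x₀)) (𝓝 0) := by
      have hshift : Tendsto (fun q : ℝ × X => q.1 - t₀) (𝓝 (t₀, x₀)) (𝓝 0) := by
        have hc : Continuous fun q : ℝ × X => q.1 - t₀ := by fun_prop
        simpa using hc.tendsto (t₀, x₀)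
      have hsub := ((tendsto x₀).comp hshift).sub_const x₀
      rw [sub_self] at hsub
      simpa only [map_zero, Function.comp_def] using ((S t₀).continuous.tendsto 0).comp hsub
    rw [← add_zero (0 : X)]
    refine (hstate.add htime).congr fun q => ?_
    rw [map_sub, map_sub, ← add, add_sub_cancel]
    exact sub_add_sub_cancel _ _ _

theorem continuous_apply (hS : IsStrongGroup S) (x : X) : Continuous fun t => S t x :=
  hS.continuous.comp (continuous_id.prodMk continuous_const)

theorem exists_norm_le [CompleteSpace X] (hS : IsStrongGroup S) (τ : ℝ) :
    ∃ M, ∀ t ∈ Icc 0 τ, ‖S t‖ ≤ M := by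
  obtain ⟨M, hM⟩ := banach_steinhaus (g := fun t : Icc 0 τ => S t) fun x => by
    obtain ⟨C, hC⟩ := isCompact_Icc.exists_bound_of_continuousOn (s := Icc 0 τ)
      (hS.continuous_apply x).continuousOn
    exact ⟨C, fun t => hC t t.2⟩
  exact ⟨M, fun t ht => hM ⟨t, ht⟩⟩

theorem exists_norm_sub_le (hS : IsStrongGroup S) (x : X) {η : ℝ} (hη : 0 < η) :
    ∃ r > 0, ∀ t ∈ Icc 0 r, ‖S t x - x‖ ≤ η := by
  obtain ⟨r, hr, h⟩ := Metric.continuous_iff.1 (hS.continuous_apply x) 0 η hη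
  refine ⟨r / 2, half_pos hr, fun t ht => ?_⟩
  have := h t (by rw [Real.dist_0_eq_abs, abs_of_nonneg ht.1]; linarith [ht.2])
  rw [hS.zero, dist_eq_norm] at this
  exact this.le

theorem continuous_convolution (hS : IsStrongGroup S) {g : ℝ → X} (hg : Continuous g)
    (t : ℝ) : Continuous fun s => S (t - s) (g s) :=
  hS.continuous.comp (by fun_prop : Continuous fun s => (t - s, g s))

theorem continuous_integral_convolution [CompleteSpace X] (hS : IsStrongGroup S)
    {g : ℝ → X} (hg : Continuous g) :
    Continuous fun t => ∫ s in (0 : ℝ)..t, S (t - s) (g s) := by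
  have hc : Continuous fun s => S (-s) (g s) := by
    simpa only [zero_sub] using hS.continuous_convolution hg 0
  have hpull : ∀ t, ∫ s in (0 : ℝ)..t, S (t - s) (g s) = S t (∫ s in (0 : ℝ)..t, S (-s) (g s)) := by
    intro t
    rw [← ContinuousLinearMap.intervalIntegral_comp_comm _ (hc.intervalIntegrable 0 t)]
    simp only [sub_eq_add_neg, hS.add]
  simp only [hpull]
  exact hS.continuous.comp (continuous_id.prodMk
    (intervalIntegral.continuous_primitive (fun a b => hc.intervalIntegrable a b) 0))

end IsStrongGroup

theorem norm_le_mul_exp_of_eq_add_integral {τ M C a : ℝ} {K : ℝ → X →L[ℝ] X} {F D : ℝ → X}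
    (hM : ∀ t ∈ Icc 0 τ, ‖S t‖ ≤ M) (hC : ∀ s ∈ Icc 0 τ, ‖K s‖ ≤ C)
    (hD : ContinuousOn D (Icc 0 τ)) (hF : ∀ t ∈ Icc 0 τ, ‖F t‖ ≤ a)
    (h : ∀ t ∈ Icc 0 τ, D t = F t + ∫ s in (0 : ℝ)..t, S (t - s) (K s (D s))) :
    ∀ t ∈ Icc 0 τ, ‖D t‖ ≤ a * Real.exp (M * C * t) := by
  intro t ht
  have hM0 : 0 ≤ M := (norm_nonneg _).trans (hM t ht)
  have hC0 : 0 ≤ C := (norm_nonneg _).trans (hC t ht)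
  refine le_mul_exp_of_le_add_mul_integral (mul_nonneg hM0 hC0) hD.norm (fun t ht => ?_) t ht
  rw [h t ht, ← intervalIntegral.integral_const_mul]
  refine (norm_add_le _ _).trans (add_le_add (hF t ht) ?_)
  refine intervalIntegral.norm_integral_le_of_norm_le ht.1
    (Eventually.of_forall fun s hs => ?_) ?_
  · have hs' : s ∈ Icc 0 τ := ⟨hs.1.le, hs.2.trans ht.2⟩
    have hts : t - s ∈ Icc 0 τ := ⟨sub_nonneg.2 hs.2, by linarith [hs.1, ht.2]⟩
    rw [mul_assoc]
    exact ((S (t - s)).le_of_opNorm_le (hM _ hts) _).trans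
      (mul_le_mul_of_nonneg_left ((K s).le_of_opNorm_le (hC s hs') _) hM0)
  · refine ContinuousOn.intervalIntegrable (continuousOn_const.mul (hD.norm.mono ?_))
    rw [uIcc_of_le ht.1]
    exact Icc_subset_Icc_right ht.2

namespace IsMild

theorem norm_sub_le {τ M C : ℝ} (hM : ∀ t ∈ Icc 0 τ, ‖S t‖ ≤ M) {K : ℝ → X →L[ℝ] X}
    (hC : ∀ s ∈ Icc 0 τ, ‖K s‖ ≤ C) {W₀ W₀' : X} {W W' : ℝ → X} (hW : IsMild S τ K W₀ W)
    (hW' : IsMild S τ K W₀' W') :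
    ∀ t ∈ Icc 0 τ, ‖W t - W' t‖ ≤ M * ‖W₀ - W₀'‖ * Real.exp (M * C * t) := by
  refine norm_le_mul_exp_of_eq_add_integral (F := fun t => S t (W₀ - W₀')) hM hC
    (hW.continuousOn.sub hW'.continuousOn) (fun t ht => (S t).le_of_opNorm_le (hM t ht) _)
    fun t ht => ?_
  rw [hW.duhamel t ht, hW'.duhamel t ht, add_sub_add_comm, ← map_sub,
    ← intervalIntegral.integral_sub (hW.integrable t ht) (hW'.integrable t ht)]
  simp only [map_sub]

theorem unique [CompleteSpace X] (hS : IsStrongGroup S) {τ C : ℝ} {K : ℝ → X →L[ℝ] X}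
    (hC : ∀ s ∈ Icc 0 τ, ‖K s‖ ≤ C) {W₀ : X} {W W' : ℝ → X} (hW : IsMild S τ K W₀ W)
    (hW' : IsMild S τ K W₀ W') : EqOn W W' (Icc 0 τ) := by
  intro t ht
  obtain ⟨M, hM⟩ := hS.exists_norm_le τ
  simpa [sub_eq_zero] using hW.norm_sub_le hM hC hW' t ht

theorem zero (hS : IsStrongGroup S) (K : ℝ → X →L[ℝ] X) (W₀ : X) :
    IsMild S 0 K W₀ fun _ => W₀ where
  continuousOn := continuousOn_const
  integrable t ht := by
    obtain rfl : t = 0 := by simpa using ht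
    simp
  duhamel t ht := by
    obtain rfl : t = 0 := by simpa using ht
    simp [hS.zero]

theorem free (hS : IsStrongGroup S) (τ : ℝ) (W₀ : X) :
    IsMild S τ (fun _ => 0) W₀ fun t => S t W₀ where
  continuousOn := (hS.continuous_apply W₀).continuousOn
  integrable t _ := by simp
  duhamel t _ := by simp

end IsMild

end Mild

/-- The function equal to `f` up to time `τ` and to `g`, started at time `τ`, afterwards. -/
def concat {E : Type*} (τ : ℝ) (f g : ℝ → E) : ℝ → E := fun s => if s ≤ τ then f s else g (s - τ)

section Concat

variable {E : Type*} {τ δ s : ℝ} {f g : ℝ → E}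

theorem concat_of_le (hs : s ≤ τ) : concat τ f g s = f s := if_pos hs

theorem concat_of_lt (hs : τ < s) : concat τ f g s = g (s - τ) := if_neg hs.not_ge

theorem concat_of_ge (hfg : f τ = g 0) (hs : τ ≤ s) : concat τ f g s = g (s - τ) := by
  rcases hs.eq_or_lt with rfl | hs
  · rw [concat_of_le le_rfl, hfg, sub_self]
  · exact concat_of_lt hs

theorem concat_const (c : E) : concat τ (fun _ => c) (fun _ => c) = fun _ => c :=
  funext fun _ => ite_self c

theorem comp_concat {F : Type*} (h : E → F) :
    (fun s => h (concat τ f g s)) = concat τ (fun s => h (f s)) fun s => h (g s) :=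
  funext fun _ => apply_ite h _ _ _

theorem continuousOn_concat [TopologicalSpace E] (hτ : 0 ≤ τ) (hδ : 0 ≤ δ) (hfg : f τ = g 0)
    (hf : ContinuousOn f (Icc 0 τ)) (hg : ContinuousOn g (Icc 0 δ)) :
    ContinuousOn (concat τ f g) (Icc 0 (τ + δ)) := by
  rw [← Icc_union_Icc_eq_Icc hτ (le_add_of_nonneg_right hδ)]
  refine ContinuousOn.union_of_isClosed ?_ ?_ isClosed_Icc isClosed_Icc
  · exact hf.congr fun s hs => concat_of_le hs.2
  · refine ContinuousOn.congr ?_ fun s hs => concat_of_ge hfg hs.1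
    exact hg.comp (by fun_prop) fun s hs => ⟨sub_nonneg.2 hs.1, by linarith [hs.2]⟩

end Concat

section MildExistence

variable {X : Type*} [NormedAddCommGroup X] [NormedSpace ℝ X] {S : ℝ → X →L[ℝ] X}

namespace IsMild

variable {τ δ : ℝ} {K K₁ K₂ : ℝ → X →L[ℝ] X} {W₀ : X} {W W₁ W₂ : ℝ → X}

theorem apply_zero (hS : IsStrongGroup S) (hτ : 0 ≤ τ) (hW : IsMild S τ K W₀ W) : W 0 = W₀ := by
  simpa [hS.zero] using hW.duhamel 0 ⟨le_rfl, hτ⟩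

theorem intervalIntegrable_add (hS : IsStrongGroup S) (hτ : 0 ≤ τ) (hW : IsMild S τ K W₀ W)
    (r : ℝ) : IntervalIntegrable (fun s => S (τ + r - s) (K s (W s))) volume 0 τ := by
  have hint := hW.integrable τ ⟨hτ, le_rfl⟩
  have heq : ∀ s, S (τ + r - s) (K s (W s)) = S r (S (τ - s) (K s (W s))) := fun s => by
    rw [← hS.add, add_comm τ, add_sub_assoc]
  simp only [heq]
  exact ⟨(S r).integrable_comp hint.1, (S r).integrable_comp hint.2⟩

theorem add_integral_eq [CompleteSpace X] (hS : IsStrongGroup S) (hτ : 0 ≤ τ)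
    (hW : IsMild S τ K W₀ W) (r : ℝ) :
    S (τ + r) W₀ + ∫ s in (0 : ℝ)..τ, S (τ + r - s) (K s (W s)) = S r (W τ) := by
  have heq : ∀ s, S (τ + r - s) (K s (W s)) = S r (S (τ - s) (K s (W s))) := fun s => by
    rw [← hS.add, add_comm τ, add_sub_assoc]
  simp only [heq]
  rw [ContinuousLinearMap.intervalIntegral_comp_comm _ (hW.integrable τ ⟨hτ, le_rfl⟩),
    add_comm τ, hS.add, ← map_add, ← hW.duhamel τ ⟨hτ, le_rfl⟩]

theorem concat [CompleteSpace X] (hS : IsStrongGroup S) (hτ : 0 ≤ τ) (hδ : 0 ≤ δ)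
    (h₁ : IsMild S τ K₁ W₀ W₁) (h₂ : IsMild S δ K₂ (W₁ τ) W₂) :
    IsMild S (τ + δ) (concat τ K₁ K₂) W₀ (concat τ W₁ W₂) := by
  have hfg : W₁ τ = W₂ 0 := (h₂.apply_zero hS hδ).symm
  set ψ : ℝ → ℝ → X := fun t s =>
    S (t - s) (BilinearWave.concat τ K₁ K₂ s (BilinearWave.concat τ W₁ W₂ s))
  have hfirst : ∀ t, ∀ a ≤ τ, 0 ≤ a →
      EqOn (fun s => S (t - s) (K₁ s (W₁ s))) (ψ t) (uIoc 0 a) := by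
    intro t a ha h0 s hs
    rw [uIoc_of_le h0] at hs
    simp only [ψ, concat_of_le (hs.2.trans ha)]
  have hsecond : ∀ r, 0 ≤ r → EqOn (fun s => S (r - (s - τ)) (K₂ (s - τ) (W₂ (s - τ))))
      (ψ (τ + r)) (uIoc τ (τ + r)) := by
    intro r hr s hs
    rw [uIoc_of_le (le_add_of_nonneg_right hr)] at hs
    simp only [ψ, concat_of_lt hs.1]
    congr 2
    ring
  have hint₁ : ∀ r, IntervalIntegrable (ψ (τ + r)) volume 0 τ := fun r =>
    (h₁.intervalIntegrable_add hS hτ r).congr (hfirst _ τ le_rfl hτ)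
  have hint₂ : ∀ r ∈ Icc 0 δ, IntervalIntegrable (ψ (τ + r)) volume τ (τ + r) := fun r hr => by
    have h := (h₂.integrable r hr).comp_sub_right τ
    rw [zero_add, add_comm r] at h
    exact h.congr (hsecond r hr.1)
  have hcases : ∀ t ∈ Icc 0 (τ + δ), t ≤ τ ∨ ∃ r ∈ Icc 0 δ, t = τ + r := fun t ht =>
    (le_total t τ).imp_right fun h =>
      ⟨t - τ, ⟨sub_nonneg.2 h, by linarith [ht.2]⟩, (add_sub_cancel _ _).symm⟩
  refine ⟨continuousOn_concat hτ hδ hfg h₁.continuousOn h₂.continuousOn,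
    fun t ht => ?_, fun t ht => ?_⟩
  · rcases hcases t ht with h | ⟨r, hr, rfl⟩
    · exact (h₁.integrable t ⟨ht.1, h⟩).congr (hfirst t t h ht.1)
    · exact (hint₁ r).trans (hint₂ r hr)
  · rcases hcases t ht with h | ⟨r, hr, rfl⟩
    · rw [concat_of_le h, h₁.duhamel t ⟨ht.1, h⟩,
        intervalIntegral.integral_congr_ae (.of_forall (hfirst t t h ht.1))]
    · rw [concat_of_ge hfg (le_add_of_nonneg_right hr.1), add_sub_cancel_left, h₂.duhamel r hr,
        ← h₁.add_integral_eq hS hτ,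
        ← intervalIntegral.integral_add_adjacent_intervals (hint₁ r) (hint₂ r hr),
        ← intervalIntegral.integral_congr_ae (.of_forall (hfirst _ τ le_rfl hτ)),
        ← intervalIntegral.integral_congr_ae (.of_forall (hsecond r hr.1)),
        intervalIntegral.integral_comp_sub_right (fun s => S (r - s) (K₂ s (W₂ s))), sub_self,
        add_sub_cancel_left, add_assoc]

end IsMild

namespace IsStrongGroup

variable {δ M : ℝ}

/-- The Picard iteration for the mild solution of `W' = (A + K) W`, `W(0) = W₀` on `[0, δ]`. -/
def picardMap [CompleteSpace X] (hS : IsStrongGroup S) (hδ : 0 ≤ δ) (K : X →L[ℝ] X) (W₀ : X)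
    (f : C(Icc 0 δ, X)) : C(Icc 0 δ, X) where
  toFun t := S t W₀ + ∫ s in (0 : ℝ)..t, S (t - s) (K (IccExtend hδ f s))
  continuous_toFun := ((hS.continuous_apply W₀).comp continuous_subtype_val).add
    ((hS.continuous_integral_convolution (K.continuous.comp f.continuous.Icc_extend')).comp
      continuous_subtype_val)

theorem dist_picardMap_le [CompleteSpace X] (hS : IsStrongGroup S) (hδ : 0 ≤ δ)
    (hM : ∀ t ∈ Icc 0 δ, ‖S t‖ ≤ M) (K : X →L[ℝ] X) (W₀ : X) (f g : C(Icc 0 δ, X)) :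
    dist (hS.picardMap hδ K W₀ f) (hS.picardMap hδ K W₀ g) ≤ δ * (M * ‖K‖) * dist f g := by
  have hM0 : 0 ≤ M := (norm_nonneg _).trans (hM 0 ⟨le_rfl, hδ⟩)
  have hint : ∀ (f : C(Icc 0 δ, X)) t,
      IntervalIntegrable (fun s => S (t - s) (K (IccExtend hδ f s))) volume 0 t := fun f t =>
    (hS.continuous_convolution (K.continuous.comp f.continuous.Icc_extend') t).intervalIntegrable
      _ _
  refine (ContinuousMap.dist_le (by positivity)).2 fun t => ?_
  simp only [picardMap, ContinuousMap.coe_mk]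
  rw [dist_add_left, dist_eq_norm, ← intervalIntegral.integral_sub (hint f t) (hint g t)]
  have hpoint : ∀ s ∈ uIoc 0 (t : ℝ), ‖S (t - s) (K (IccExtend hδ f s))
      - S (t - s) (K (IccExtend hδ g s))‖ ≤ M * (‖K‖ * dist f g) := by
    intro s hs
    rw [uIoc_of_le t.2.1] at hs
    rw [← map_sub, ← map_sub]
    refine (S (t - s)).le_of_opNorm_le_of_le
      (hM _ ⟨sub_nonneg.2 hs.2, by linarith [hs.1, t.2.2]⟩) (K.le_opNorm_of_le ?_)
    rw [← dist_eq_norm]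
    exact ContinuousMap.dist_apply_le_dist _
  refine (intervalIntegral.norm_integral_le_of_norm_le_const hpoint).trans ?_
  rw [sub_zero, abs_of_nonneg t.2.1]
  refine (mul_le_mul_of_nonneg_left t.2.2 (by positivity)).trans_eq ?_
  ring

theorem exists_isMild_of_small [CompleteSpace X] (hS : IsStrongGroup S) (hδ : 0 ≤ δ)
    (hM : ∀ t ∈ Icc 0 δ, ‖S t‖ ≤ M) {K : X →L[ℝ] X} (hK : δ * (M * ‖K‖) ≤ 1 / 2) (W₀ : X) :
    ∃ W, IsMild S δ (fun _ => K) W₀ W := by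
  have hcontr : ContractingWith (1 / 2) (hS.picardMap hδ K W₀) :=
    ⟨NNReal.half_lt_self one_ne_zero, LipschitzWith.of_dist_le_mul fun f g =>
      (hS.dist_picardMap_le hδ hM K W₀ f g).trans
        (mul_le_mul_of_nonneg_right (by simpa using hK) dist_nonneg)⟩
  obtain ⟨f, hf⟩ : ∃ f, hS.picardMap hδ K W₀ f = f := ⟨_, hcontr.fixedPoint_isFixedPt⟩
  refine ⟨IccExtend hδ f, f.continuous.Icc_extend'.continuousOn, fun t _ =>
    (hS.continuous_convolution (K.continuous.comp f.continuous.Icc_extend') t).intervalIntegrable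
      _ _, fun t ht => ?_⟩
  rw [IccExtend_of_mem hδ f ht]
  exact (DFunLike.congr_fun hf ⟨t, ht⟩).symm

theorem exists_isMild [CompleteSpace X] (hS : IsStrongGroup S) (hδ : 0 ≤ δ) (K : X →L[ℝ] X)
    (W₀ : X) : ∃ W, IsMild S δ (fun _ => K) W₀ W := by
  obtain ⟨M, hM⟩ := hS.exists_norm_le δ
  obtain ⟨n, hn⟩ := exists_nat_ge (2 * (δ * (M * ‖K‖)))
  set N : ℝ := n + 1 with hN
  have hN0 : 0 < N := by positivity
  have hstep0 : 0 ≤ δ / N := by positivity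
  have hstep : ∀ W₁, ∃ W, IsMild S (δ / N) (fun _ => K) W₁ W := by
    refine hS.exists_isMild_of_small hstep0
      (fun t ht => hM t ⟨ht.1, ht.2.trans (div_le_self hδ (by simp [hN]))⟩) ?_
    rw [div_mul_eq_mul_div, div_le_iff₀ hN0]
    linarith
  have hiter : ∀ m : ℕ, ∃ W, IsMild S (m * (δ / N)) (fun _ => K) W₀ W := by
    intro m
    induction m with
    | zero => exact ⟨_, by simpa using IsMild.zero hS (fun _ => K) W₀⟩
    | succ m ih =>
      obtain ⟨W₁, h₁⟩ := ih
      obtain ⟨W₂, h₂⟩ := hstep (W₁ (m * (δ / N)))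
      have h := h₁.concat hS (by positivity) hstep0 h₂
      rw [concat_const, ← add_one_mul, ← Nat.cast_succ] at h
      exact ⟨_, h⟩
  have hend : ((n + 1 : ℕ) : ℝ) * (δ / N) = δ := by
    rw [Nat.cast_succ, ← hN, mul_div_cancel₀ _ hN0.ne']
  exact hend ▸ hiter (n + 1)

theorem exists_propagator [CompleteSpace X] (hS : IsStrongGroup S) (hδ : 0 ≤ δ)
    (K : X →L[ℝ] X) :
    ∃ L : X → X, Continuous L ∧ ∀ W₀, ∃ W, IsMild S δ (fun _ => K) W₀ W ∧ W δ = L W₀ := by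
  obtain ⟨M, hM⟩ := hS.exists_norm_le δ
  choose W hW using hS.exists_isMild hδ K
  refine ⟨fun W₀ => W W₀ δ, ?_, fun W₀ => ⟨W W₀, hW W₀, rfl⟩⟩
  have hδmem : δ ∈ Icc 0 δ := ⟨hδ, le_rfl⟩
  refine (LipschitzWith.of_dist_le' (K := M * Real.exp (M * ‖K‖ * δ))
    fun W₀ W₀' => ?_).continuous
  rw [dist_eq_norm, dist_eq_norm]
  refine ((hW W₀).norm_sub_le hM (fun _ _ => le_rfl) (hW W₀') δ hδmem).trans_eq ?_
  ring

end IsStrongGroup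

/-- With `K² = 0` the line `t ↦ W₀ + (t / δ) K W₀` solves `W' = δ⁻¹ K W`, so it can differ from `W`
only through the free evolution, which is almost stationary for a short time. -/
theorem IsMild.norm_sub_add_apply_le [CompleteSpace X] {δ M η : ℝ} (hδ : 0 < δ)
    (hM : ∀ t ∈ Icc 0 δ, ‖S t‖ ≤ M) {K : X →L[ℝ] X} (hKK : ∀ x, K (K x) = 0) {W₀ : X}
    {W : ℝ → X} (hS : IsStrongGroup S) (hW : IsMild S δ (fun _ => δ⁻¹ • K) W₀ W)
    (h₁ : ∀ t ∈ Icc 0 δ, ‖S t W₀ - W₀‖ ≤ η) (h₂ : ∀ t ∈ Icc 0 δ, ‖S t (K W₀) - K W₀‖ ≤ η) :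
    ‖W δ - (W₀ + K W₀)‖ ≤ 2 * η * Real.exp (M * ‖K‖) := by
  set D : ℝ → X := fun t => W t - (W₀ + (t * δ⁻¹) • K W₀)
  set F : ℝ → X := fun t =>
    S t W₀ - W₀ + ∫ s in (0 : ℝ)..t, δ⁻¹ • (S (t - s) (K W₀) - K W₀)
  have hKD : ∀ s, (δ⁻¹ • K) (D s) = (δ⁻¹ • K) (W s) - δ⁻¹ • K W₀ := fun s => by
    simp [D, hKK, smul_sub]
  have hcont : ∀ t, Continuous fun s => S (t - s) (δ⁻¹ • K W₀) := fun t =>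
    hS.continuous_convolution continuous_const t
  have hD : ∀ t ∈ Icc 0 δ, D t = F t + ∫ s in (0 : ℝ)..t, S (t - s) ((δ⁻¹ • K) (D s)) := by
    intro t ht
    have hline : (t * δ⁻¹) • K W₀ = ∫ _ in (0 : ℝ)..t, δ⁻¹ • K W₀ := by
      rw [intervalIntegral.integral_const, sub_zero, smul_smul]
    simp only [F, hKD, map_sub, smul_sub, ← map_smul (S _)]
    rw [intervalIntegral.integral_sub ((hcont t).intervalIntegrable _ _)
        (continuous_const.intervalIntegrable _ _),
      intervalIntegral.integral_sub (hW.integrable t ht) ((hcont t).intervalIntegrable _ _),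
      ← hline]
    simp only [D]
    rw [hW.duhamel t ht]
    abel
  have hF : ∀ t ∈ Icc 0 δ, ‖F t‖ ≤ 2 * η := by
    intro t ht
    have hη : 0 ≤ η := (norm_nonneg _).trans (h₁ t ht)
    rw [two_mul]
    refine (norm_add_le _ _).trans (add_le_add (h₁ t ht) ?_)
    refine (intervalIntegral.norm_integral_le_of_norm_le_const (C := δ⁻¹ * η) fun s hs => ?_).trans
      ?_
    · rw [uIoc_of_le ht.1] at hs
      rw [norm_smul, norm_inv, Real.norm_of_nonneg hδ.le]
      exact mul_le_mul_of_nonneg_left (h₂ _ ⟨sub_nonneg.2 hs.2, by linarith [hs.1, ht.2]⟩)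
        (inv_nonneg.2 hδ.le)
    · rw [sub_zero, abs_of_nonneg ht.1, mul_comm, ← mul_assoc, ← div_eq_mul_inv]
      exact mul_le_of_le_one_left hη ((div_le_one hδ).2 ht.2)
  have h := norm_le_mul_exp_of_eq_add_integral (D := D) hM (fun _ _ => le_rfl)
    (hW.continuousOn.sub (by fun_prop)) hF hD δ ⟨hδ.le, le_rfl⟩
  have hexp : M * ‖δ⁻¹ • K‖ * δ = M * ‖K‖ := by
    rw [norm_smul, norm_inv, Real.norm_of_nonneg hδ.le]
    field_simp
  rwa [hexp, show D δ = W δ - (W₀ + K W₀) by simp [D, hδ.ne']] at h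

end MildExistence

/-! ### Approximate reachability -/

theorem isPiecewiseConstant_zero {E : Type*} (p : ℝ → E) : IsPiecewiseConstant 0 p :=
  ⟨0, fun _ => 0, Subsingleton.strictMono (α := Fin 1) _, rfl, rfl, fun i => i.elim0⟩

theorem IsPiecewiseConstant.concat_const {E : Type*} {τ δ : ℝ} {p : ℝ → E}
    (hp : IsPiecewiseConstant τ p) (hδ : 0 < δ) (c : E) :
    IsPiecewiseConstant (τ + δ) (concat τ p fun _ => c) := by
  obtain ⟨N, t, ht, h0, hN, hc⟩ := hp
  refine ⟨N + 1, Fin.snoc (α := fun _ => ℝ) t (τ + δ), Fin.strictMono_iff_lt_succ.2 fun i => ?_,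
    ?_, Fin.snoc_last _ _, fun i => ?_⟩
  · refine Fin.lastCases ?_ (fun i => ?_) i
    · rw [Fin.succ_last, Fin.snoc_last, Fin.snoc_castSucc, hN]
      exact lt_add_of_pos_right τ hδ
    · rw [Fin.succ_castSucc, Fin.snoc_castSucc, Fin.snoc_castSucc]
      exact ht Fin.castSucc_lt_succ
  · rw [← Fin.castSucc_zero, Fin.snoc_castSucc, h0]
  · refine Fin.lastCases ⟨c, fun s hs => ?_⟩ (fun i => ?_) i
    · rw [Fin.snoc_castSucc, hN] at hs
      exact concat_of_lt hs.1
    · obtain ⟨e, he⟩ := hc i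
      refine ⟨e, fun s hs => ?_⟩
      rw [Fin.succ_castSucc, Fin.snoc_castSucc, Fin.snoc_castSucc] at hs
      exact (concat_of_le (hs.2.le.trans (hN ▸ ht.monotone (Fin.le_last _)))).trans (he s hs)

section Reachability

variable {X P : Type*} [NormedAddCommGroup X] [NormedSpace ℝ X] [AddCommGroup P] [Module ℝ P]

/-- `L` is the time-`τ` map of `W' = (A + B (p t)) W`, with `A` the generator of `S`, for some
piecewise constant control `p`. The control is recorded as a list of constant pieces, so that
concatenating two of them does not require gluing two subdivisions. -/
inductive ControlFlow (S : ℝ → X →L[ℝ] X) (B : P →ₗ[ℝ] (X →L[ℝ] X)) : ℝ → (X → X) → Prop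
  | refl : ControlFlow S B 0 id
  | step {τ δ : ℝ} {L L' : X → X} (c : P) : ControlFlow S B τ L → 0 < δ → Continuous L' →
      (∀ W₀, ∃ W, IsMild S δ (fun _ => B c) W₀ W ∧ W δ = L' W₀) →
      ControlFlow S B (τ + δ) (L' ∘ L)

variable {S : ℝ → X →L[ℝ] X} {B : P →ₗ[ℝ] (X →L[ℝ] X)} {τ τ' T T' : ℝ} {L L' : X → X}
  {W W' W'' : X}

namespace ControlFlow

theorem single {δ : ℝ} (c : P) (hδ : 0 < δ) (hL : Continuous L)
    (h : ∀ W₀, ∃ W, IsMild S δ (fun _ => B c) W₀ W ∧ W δ = L W₀) : ControlFlow S B δ L := by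
  simpa using refl.step c hδ hL h

theorem nonneg (h : ControlFlow S B τ L) : 0 ≤ τ := by
  induction h with
  | refl => exact le_rfl
  | step _ _ hδ _ _ ih => exact add_nonneg ih hδ.le

theorem continuous (h : ControlFlow S B τ L) : Continuous L := by
  induction h with
  | refl => exact continuous_id
  | step _ _ _ hL _ ih => exact hL.comp ih

theorem comp (h : ControlFlow S B τ L) (h' : ControlFlow S B τ' L') :
    ControlFlow S B (τ + τ') (L' ∘ L) := by
  induction h' with
  | refl => rwa [add_zero]
  | step c _ hδ hL' hW ih =>
    rw [← add_assoc]
    exact step (L := _ ∘ L) c ih hδ hL' hW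

theorem exists_control [CompleteSpace X] (hS : IsStrongGroup S) (h : ControlFlow S B τ L) :
    ∃ p : ℝ → P, IsPiecewiseConstant τ p ∧ (∃ C, ∀ s, ‖B (p s)‖ ≤ C) ∧
      ∀ W₀, ∃ W, IsMild S τ (fun s => B (p s)) W₀ W ∧ W τ = L W₀ := by
  induction h with
  | refl =>
    exact ⟨fun _ => 0, isPiecewiseConstant_zero _, ⟨_, fun _ => le_rfl⟩, fun W₀ =>
      ⟨_, IsMild.zero hS _ W₀, rfl⟩⟩
  | @step τ δ L L' c hτ hδ _ hW ih =>
    obtain ⟨p, hp, ⟨C, hC⟩, hsol⟩ := ih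
    refine ⟨_, hp.concat_const hδ c, ⟨max C ‖B c‖, fun s => ?_⟩, fun W₀ => ?_⟩
    · rcases le_or_gt s τ with hs | hs
      · exact concat_of_le hs ▸ (hC s).trans (le_max_left _ _)
      · exact concat_of_lt hs ▸ le_max_right _ _
    · obtain ⟨W₁, hW₁, hL₁⟩ := hsol W₀
      obtain ⟨W₂, hW₂, hL₂⟩ := hW (L W₀)
      rw [← hL₁] at hW₂
      refine ⟨concat τ W₁ W₂, ?_, ?_⟩
      · rw [comp_concat B]
        exact hW₁.concat hS hτ.nonneg hδ.le hW₂
      · rw [concat_of_lt (lt_add_of_pos_right τ hδ), add_sub_cancel_left, hL₂,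
          Function.comp_apply]

end ControlFlow

/-- Piecewise constant controls steer `W` arbitrarily close to `W'` within time `T`. -/
def ReachIn (S : ℝ → X →L[ℝ] X) (B : P →ₗ[ℝ] (X →L[ℝ] X)) (T : ℝ) (W W' : X) : Prop :=
  ∀ ε > 0, ∃ τ ≤ T, ∃ L, ControlFlow S B τ L ∧ ‖L W - W'‖ < ε

namespace ReachIn

theorem trans (h : ReachIn S B T W W') (h' : ReachIn S B T' W' W'') :
    ReachIn S B (T + T') W W'' := by
  intro ε hε
  obtain ⟨τ', hτ', L', hL', hW'⟩ := h' (ε / 2) (half_pos hε)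
  obtain ⟨r, hr, hcont⟩ := Metric.continuousAt_iff.1 (hL'.continuous.continuousAt (x := W'))
    (ε / 2) (half_pos hε)
  obtain ⟨τ, hτ, L, hL, hW⟩ := h r hr
  refine ⟨τ + τ', add_le_add hτ hτ', L' ∘ L, hL.comp hL', ?_⟩
  have hLW : ‖L' (L W) - L' W'‖ < ε / 2 := by
    simpa only [dist_eq_norm] using hcont (x := L W) (by rwa [dist_eq_norm])
  have htri := norm_sub_le_norm_sub_add_norm_sub (L' (L W)) (L' W') W''
  simp only [Function.comp_apply]
  linarith

theorem of_approx (h : ∀ ε > 0, ∃ W'', ReachIn S B T W W'' ∧ ‖W'' - W'‖ < ε) :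
    ReachIn S B T W W' := by
  intro ε hε
  obtain ⟨W'', hreach, hnear⟩ := h (ε / 2) (half_pos hε)
  obtain ⟨τ, hτ, L, hL, hLW⟩ := hreach (ε / 2) (half_pos hε)
  have htri := norm_sub_le_norm_sub_add_norm_sub (L W) W'' W'
  exact ⟨τ, hτ, L, hL, by linarith⟩

theorem mono (h : ReachIn S B T W W') (hT : T ≤ T') : ReachIn S B T' W W' := by
  intro ε hε
  obtain ⟨τ, hτ, L, hL, hLW⟩ := h ε hε
  exact ⟨τ, hτ.trans hT, L, hL, hLW⟩

theorem free (hS : IsStrongGroup S) {t : ℝ} (ht : 0 < t) (W : X) : ReachIn S B t W (S t W) :=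
  fun ε hε => ⟨t, le_rfl, S t, .single 0 ht (S t).continuous fun W₀ =>
    ⟨_, by simpa using IsMild.free hS t W₀, rfl⟩, by simpa using hε⟩

end ReachIn

/-- Every state `W` can be steered approximately to `W + K W` in arbitrarily small time. -/
def Impulse (S : ℝ → X →L[ℝ] X) (B : P →ₗ[ℝ] (X →L[ℝ] X)) (K : X →L[ℝ] X) : Prop :=
  ∀ T > 0, ∀ W, ReachIn S B T W (W + K W)

namespace Impulse

theorem add {K K' : X →L[ℝ] X} (h : Impulse S B K) (h' : Impulse S B K')
    (hK : ∀ x, K' (K x) = 0) : Impulse S B (K + K') := by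
  intro T hT W
  have := (h (T / 2) (half_pos hT) W).trans (h' (T / 2) (half_pos hT) (W + K W))
  rw [add_halves, map_add, hK, add_zero, add_assoc] at this
  exact this

theorem of_approx {K : X →L[ℝ] X}
    (h : ∀ W, ∀ ε > 0, ∃ K', Impulse S B K' ∧ ‖K' W - K W‖ < ε) : Impulse S B K := by
  refine fun T hT W => ReachIn.of_approx fun ε hε => ?_
  obtain ⟨K', hK', hnear⟩ := h W ε hε
  exact ⟨W + K' W, hK' T hT W, by rwa [add_sub_add_left_eq_sub]⟩

theorem of_control [CompleteSpace X] (hS : IsStrongGroup S) (c : P)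
    (hBB : ∀ x, B c (B c x) = 0) : Impulse S B (B c) := by
  intro T hT W ε hε
  obtain ⟨M, hM⟩ := hS.exists_norm_le T
  obtain ⟨η, hη, hηε⟩ : ∃ η > 0, 2 * η * Real.exp (M * ‖B c‖) < ε := by
    refine ⟨ε / (4 * Real.exp (M * ‖B c‖)), by positivity, ?_⟩
    field_simp
    norm_num
  obtain ⟨r₁, hr₁, h₁⟩ := hS.exists_norm_sub_le W hη
  obtain ⟨r₂, hr₂, h₂⟩ := hS.exists_norm_sub_le (B c W) hη
  obtain ⟨δ, hδ, hδT, hδ₁, hδ₂⟩ : ∃ δ > 0, δ ≤ T ∧ δ ≤ r₁ ∧ δ ≤ r₂ :=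
    ⟨min T (min r₁ r₂), by positivity, by simp⟩
  obtain ⟨L, hL, hLsol⟩ := hS.exists_propagator hδ.le (δ⁻¹ • B c)
  refine ⟨δ, hδT, L, .single (δ⁻¹ • c) hδ hL (by simpa only [map_smul] using hLsol), ?_⟩
  obtain ⟨V, hV, hVL⟩ := hLsol W
  rw [← hVL]
  exact (hV.norm_sub_add_apply_le hδ (fun t ht => hM t ⟨ht.1, ht.2.trans hδT⟩) hBB hS
    (fun t ht => h₁ t ⟨ht.1, ht.2.trans hδ₁⟩) fun t ht => h₂ t ⟨ht.1, ht.2.trans hδ₂⟩).trans_lt hηε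

end Impulse

section Saturation

open Asymptotics

variable {K D : X →L[ℝ] X}

theorem tendsto_inv_smul_comp_sq {f : ℝ → X} (hf : f =O[𝓝 0] fun t => t) :
    Tendsto (fun r : ℝ => r⁻¹ • f (r ^ 2)) (𝓝[>] 0) (𝓝 0) := by
  have hsq : Tendsto (fun r : ℝ => r ^ 2) (𝓝 0) (𝓝 0) := by
    simpa using (continuous_pow 2).tendsto (0 : ℝ)
  exact (((hf.comp_tendsto hsq).trans_isLittleO
    (isLittleO_pow_id one_lt_two)).mono nhdsWithin_le_nhds).tendsto_inv_smul_nhds_zero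

theorem tendsto_sq_nhdsGT_zero : Tendsto (fun r : ℝ => r ^ 2) (𝓝[>] 0) (𝓝[>] 0) := by
  have hsq : Tendsto (fun r : ℝ => r ^ 2) (𝓝 0) (𝓝 0) := by
    simpa using (continuous_pow 2).tendsto (0 : ℝ)
  refine tendsto_nhdsWithin_iff.2 ⟨hsq.mono_left nhdsWithin_le_nhds, ?_⟩
  filter_upwards [self_mem_nhdsWithin] with r hr
  exact pow_pos (mem_Ioi.1 hr) 2

theorem IsStrongGroup.tendsto_conj_impulse (hS : IsStrongGroup S) (W : X)
    (hSK : (fun t => S t (K W) - K W) =O[𝓝 0] fun t => t)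
    (hKS : (fun t => K (S t W - W)) =O[𝓝 0] fun t => t)
    (hD : Tendsto (fun t : ℝ => t⁻¹ • K (S t (K W))) (𝓝[>] 0) (𝓝 (D W))) :
    Tendsto (fun r : ℝ => S (r ^ 2) (W + r⁻¹ • K W) - r⁻¹ • K (S (r ^ 2) (W + r⁻¹ • K W)))
      (𝓝[>] 0) (𝓝 (W - D W)) := by
  have hfree : Tendsto (fun t => S t W) (𝓝[>] 0) (𝓝 W) := by
    simpa only [hS.zero] using ((hS.continuous_apply W).tendsto 0).mono_left nhdsWithin_le_nhds
  have hlim := (((hfree.comp tendsto_sq_nhdsGT_zero).add (tendsto_inv_smul_comp_sq hSK)).sub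
    (tendsto_inv_smul_comp_sq hKS)).sub (hD.comp tendsto_sq_nhdsGT_zero)
  rw [add_zero, sub_zero] at hlim
  refine hlim.congr fun r => ?_
  simp only [Function.comp_apply, map_add, map_smul, map_sub, sq, mul_inv]
  module

/-- Conjugating the free evolution during the time `r²` by the impulses `± r⁻¹ K` gives the
impulse `-D` as `r → 0`. -/
theorem Impulse.neg_of_tendsto (hS : IsStrongGroup S) (hK : ∀ c : ℝ, Impulse S B (c • K))
    (hSK : ∀ W, (fun t => S t (K W) - K W) =O[𝓝 0] fun t => t)
    (hKS : ∀ W, (fun t => K (S t W - W)) =O[𝓝 0] fun t => t)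
    (hD : ∀ W, Tendsto (fun t : ℝ => t⁻¹ • K (S t (K W))) (𝓝[>] 0) (𝓝 (D W))) :
    Impulse S B (-D) := by
  intro T hT W
  refine ReachIn.of_approx fun ε hε => ?_
  have hsmall : ∀ᶠ r : ℝ in 𝓝[>] 0, r ^ 2 < T / 3 :=
    tendsto_sq_nhdsGT_zero.eventually (mem_nhdsWithin_of_mem_nhds (Iio_mem_nhds (by positivity)))
  obtain ⟨r, ⟨hnear, hrT⟩, hr⟩ := (((Metric.tendsto_nhds.1
    (hS.tendsto_conj_impulse W (hSK W) (hKS W) (hD W)) ε hε).and hsmall).and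
    self_mem_nhdsWithin).exists
  set V := S (r ^ 2) (W + r⁻¹ • K W)
  have hto : ReachIn S B (T / 3) W (W + r⁻¹ • K W) := hK r⁻¹ (T / 3) (by positivity) W
  have hfree : ReachIn S B (T / 3) (W + r⁻¹ • K W) V :=
    (ReachIn.free hS (pow_pos (mem_Ioi.1 hr) 2) _).mono hrT.le
  have hback : ReachIn S B (T / 3) V (V + (-r⁻¹) • K V) := hK (-r⁻¹) (T / 3) (by positivity) V
  refine ⟨_, ((hto.trans hfree).trans hback).mono (by linarith), ?_⟩
  rwa [neg_apply, neg_smul, ← sub_eq_add_neg, ← sub_eq_add_neg, ← dist_eq_norm]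

end Saturation

end Reachability

/-! ### Fourier series on the torus -/

section Modes

variable {d : ℕ}

theorem expMode_add (k l : Fin d → ℤ) : expMode (k + l) = expMode k * expMode l := by
  ext x
  simp [expMode, Finset.prod_mul_distrib]

theorem expMode_zero : expMode (0 : Fin d → ℤ) = 1 := by
  ext x
  simp [expMode]

theorem expMode_single (i : Fin d) (x : Torus d) :
    expMode (Pi.single i 1) x = fourier 1 (x i) := by
  have fourier_single : ∀ j : Fin d, fourier ((Pi.single i (1 : ℤ) : Fin d → ℤ) j) (x j)
      = if j = i then (fourier 1 (x i) : ℂ) else 1 := by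
    intro j
    split_ifs with hj
    · subst hj
      simp only [Pi.single_eq_same]
    · simp only [Pi.single_eq_of_ne hj, fourier_zero]
  simp only [expMode, ContinuousMap.coe_mk, fourier_single]
  simp

theorem phi_apply (k : Fin d → ℤ) (x : Torus d) :
    phi k x = (((2 * π) ^ (-(d : ℝ) / 2) : ℝ) : ℂ) * expMode k x := rfl

theorem conj_phi (k : Fin d → ℤ) (x : Torus d) :
    (starRingEnd ℂ) (phi k x) = phi (-k) x := by
  rw [phi_apply, phi_apply, map_mul, Complex.conj_ofReal, conj_expMode]

theorem expMode_mul_phi (k l : Fin d → ℤ) (x : Torus d) :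
    expMode k x * phi l x = phi (k + l) x := by
  rw [phi_apply, phi_apply, expMode_add, ContinuousMap.mul_apply]
  ring

theorem eigen_neg (k : Fin d → ℤ) : eigen (-k) = eigen k := by
  simp [eigen]

theorem one_add_eigen_pos (k : Fin d → ℤ) : 0 < 1 + eigen k := by
  linarith [eigen_nonneg k]

theorem one_le_eigen {k : Fin d → ℤ} (hk : k ≠ 0) : 1 ≤ eigen k := by
  obtain ⟨i, hi⟩ := Function.ne_iff.mp hk
  have one_le_sq : (1 : ℝ) ≤ (k i : ℝ) ^ 2 := by
    exact_mod_cast Int.one_le_abs (pow_ne_zero 2 hi) |>.trans_eq (abs_sq _)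
  exact one_le_sq.trans (Finset.single_le_sum (f := fun i => (k i : ℝ) ^ 2)
    (fun _ _ => sq_nonneg _) (Finset.mem_univ i))

theorem volume_real_univ_torus (d : ℕ) :
    (volume : Measure (Torus d)).real univ = (2 * π) ^ d := by
  rw [measureReal_def, ← Set.pi_univ univ, volume_pi_pi]
  simp [AddCircle.measure_univ, Real.pi_pos.le]

theorem rpow_neg_half_mul_self_mul_pow {a : ℝ} (ha : 0 < a) (n : ℕ) :
    a ^ (-(n : ℝ) / 2) * a ^ (-(n : ℝ) / 2) * a ^ n = 1 := by
  rw [← Real.rpow_natCast, ← Real.rpow_add ha, ← Real.rpow_add ha]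
  ring_nf
  exact Real.rpow_zero _

theorem integral_phi_mul_conj (k j : Fin d → ℤ) :
    ∫ x, phi k x * (starRingEnd ℂ) (phi j x) = if k = j then 1 else 0 := by
  set r : ℝ := (2 * π) ^ (-(d : ℝ) / 2) with hr
  have product (x : Torus d) :
      phi k x * (starRingEnd ℂ) (phi j x) = ((r : ℂ) * r) * expMode (k - j) x := by
    rw [phi_apply, phi_apply, map_mul, Complex.conj_ofReal, ← expMode_mul_conj]
    ring
  simp_rw [product]
  rw [integral_const_mul]
  split_ifs with hkj
  · have total : ∫ x : Torus d, expMode (k - j) x = (((2 * π) ^ d : ℝ) : ℂ) := by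
      simp [hkj, expMode_zero, volume_real_univ_torus]
    rw [total, hr]
    exact_mod_cast rpow_neg_half_mul_self_mul_pow Real.two_pi_pos d
  · rw [integral_expMode (sub_ne_zero.2 hkj), mul_zero]

end Modes

section HilbertBasis

/-- The star subalgebra of `C(Torus d, ℂ)` generated by the exponentials `e^{ikx}`; it is dense by
the Stone–Weierstrass theorem. -/
def expModeSubalgebra (d : ℕ) : StarSubalgebra ℂ C(Torus d, ℂ) where
  toSubalgebra := Algebra.adjoin ℂ (range expMode)
  star_mem' := by
    change Algebra.adjoin ℂ (range expMode) ≤ star (Algebra.adjoin ℂ (range expMode))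
    refine Algebra.adjoin_le ?_
    rintro _ ⟨k, rfl⟩
    refine Algebra.subset_adjoin ⟨-k, ?_⟩
    ext1 x
    exact (conj_expMode k x).symm

theorem toSubmodule_expModeSubalgebra (d : ℕ) :
    (expModeSubalgebra d).toSubalgebra.toSubmodule = Submodule.span ℂ (range expMode) := by
  apply Algebra.adjoin_eq_span_of_subset
  refine .trans (fun x ↦ Submonoid.closure_induction (fun _ ↦ id) ⟨0, expMode_zero⟩ ?_)
    Submodule.subset_span
  rintro _ _ _ _ ⟨m, rfl⟩ ⟨n, rfl⟩
  exact ⟨m + n, expMode_add m n⟩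

theorem separatesPoints_expModeSubalgebra (d : ℕ) : (expModeSubalgebra d).SeparatesPoints := by
  intro x y hxy
  obtain ⟨i, hi⟩ := Function.ne_iff.mp hxy
  refine ⟨_, ⟨expMode (Pi.single i 1), Algebra.subset_adjoin ⟨Pi.single i 1, rfl⟩, rfl⟩, ?_⟩
  dsimp only
  rw [expMode_single, expMode_single, fourier_one, fourier_one]
  exact fun h => hi (AddCircle.injective_toCircle Real.two_pi_pos.ne' (Subtype.ext h))

theorem topologicalClosure_span_expMode (d : ℕ) :
    (Submodule.span ℂ (range (expMode (d := d)))).topologicalClosure = ⊤ := by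
  rw [← toSubmodule_expModeSubalgebra]
  exact congr_arg (Subalgebra.toSubmodule <| StarSubalgebra.toSubalgebra ·)
    (ContinuousMap.starSubalgebra_topologicalClosure_eq_top_of_separatesPoints _
      (separatesPoints_expModeSubalgebra d))

theorem span_range_smul_of_ne_zero {K V ι : Type*} [Field K] [AddCommGroup V] [Module K V]
    {c : K} (hc : c ≠ 0) (v : ι → V) :
    Submodule.span K (range fun i => c • v i) = Submodule.span K (range v) := by
  refine le_antisymm (Submodule.span_le.2 ?_) (Submodule.span_le.2 ?_) <;> rintro _ ⟨i, rfl⟩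
  · exact Submodule.smul_mem _ c (Submodule.subset_span ⟨i, rfl⟩)
  · have mem := Submodule.smul_mem (Submodule.span K (range fun i => c • v i)) c⁻¹
      (Submodule.subset_span ⟨i, rfl⟩)
    rwa [inv_smul_smul₀ hc] at mem

theorem topologicalClosure_span_phi (d : ℕ) :
    (Submodule.span ℂ (range (phi (d := d)))).topologicalClosure = ⊤ := by
  rw [← topologicalClosure_span_expMode]
  exact congrArg Submodule.topologicalClosure (span_range_smul_of_ne_zero
    (Complex.ofReal_ne_zero.2 (Real.rpow_pos_of_pos Real.two_pi_pos _).ne') _)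

/-- The function `φ_k` as an element of the complex `L²` space. -/
def phiLp {d : ℕ} (k : Fin d → ℤ) : Lp ℂ 2 (volume : Measure (Torus d)) :=
  ContinuousMap.toLp 2 volume ℂ (phi k)

theorem coeFn_phiLp {d : ℕ} (k : Fin d → ℤ) : phiLp k =ᵐ[volume] phi k :=
  ContinuousMap.coeFn_toLp volume (phi k)

theorem orthonormal_phiLp (d : ℕ) : Orthonormal ℂ (phiLp (d := d)) := by
  rw [orthonormal_iff_ite]
  intro k j
  rw [phiLp, phiLp, ContinuousMap.inner_toLp]
  simpa only [eq_comm] using integral_phi_mul_conj j k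

theorem topologicalClosure_span_phiLp (d : ℕ) :
    (Submodule.span ℂ (range (phiLp (d := d)))).topologicalClosure = ⊤ := by
  simpa only [Submodule.map_span, ContinuousLinearMap.coe_coe, ← range_comp] using!
    (ContinuousMap.toLp_denseRange (p := 2) ℂ (volume : Measure (Torus d)) ℂ
      (by norm_num)).topologicalClosure_map_submodule (topologicalClosure_span_phi d)

/-- The Hilbert basis `(φ_k)` of the complex `L²` space. -/
def phiBasis (d : ℕ) : HilbertBasis (Fin d → ℤ) ℂ (Lp ℂ 2 (volume : Measure (Torus d))) :=
  HilbertBasis.mk (orthonormal_phiLp d) (topologicalClosure_span_phiLp d).ge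

theorem coe_phiBasis (d : ℕ) : ⇑(phiBasis d) = phiLp := HilbertBasis.coe_mk _ _

theorem phiBasis_repr_apply {d : ℕ} (z : Lp ℂ 2 (volume : Measure (Torus d))) (k : Fin d → ℤ) :
    (phiBasis d).repr z k = ∫ x, z x * (starRingEnd ℂ) (phi k x) := by
  rw [HilbertBasis.repr_apply_apply, coe_phiBasis, L2.inner_def]
  refine integral_congr_ae ?_
  filter_upwards [coeFn_phiLp k] with x hx
  rw [hx]
  rfl

/-- The complexification `L²(ℝ) → L²(ℂ)`, through which real functions inherit the Fourier theory
of the Hilbert basis `phiBasis`. -/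
def toComplex {d : ℕ} (w : L2 d) : Lp ℂ 2 (volume : Measure (Torus d)) :=
  ((Lp.memLp w).ofReal (K := ℂ)).toLp _

theorem coeFn_toComplex {d : ℕ} (w : L2 d) :
    toComplex w =ᵐ[volume] fun x => ((w x : ℝ) : ℂ) := MemLp.coeFn_toLp _

theorem norm_toComplex {d : ℕ} (w : L2 d) : ‖toComplex w‖ = ‖w‖ := by
  rw [toComplex, Lp.norm_toLp, Lp.norm_def]
  congr 1
  exact eLpNorm_congr_norm_ae (Eventually.of_forall fun x => by simp)

theorem phiBasis_repr_toComplex {d : ℕ} (w : L2 d) (k : Fin d → ℤ) :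
    (phiBasis d).repr (toComplex w) k = coeff w k := by
  rw [phiBasis_repr_apply]
  refine integral_congr_ae ?_
  filter_upwards [coeFn_toComplex w] with x hx
  rw [hx]

/-- The real part `L²(ℂ) → L²(ℝ)`. -/
def reLp (d : ℕ) : Lp ℂ 2 (volume : Measure (Torus d)) →L[ℝ] L2 d :=
  Complex.reCLM.compLpL 2 volume

theorem coeFn_reLp {d : ℕ} (z : Lp ℂ 2 (volume : Measure (Torus d))) :
    reLp d z =ᵐ[volume] fun x => (z x).re :=
  Complex.reCLM.coeFn_compLp z

theorem reLp_toComplex {d : ℕ} (w : L2 d) : reLp d (toComplex w) = w := by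
  refine Lp.ext ?_
  filter_upwards [coeFn_reLp (toComplex w), coeFn_toComplex w] with x hre hx
  rw [hre, hx, Complex.ofReal_re]

end HilbertBasis

section Coefficients

variable {d : ℕ}

/-- The Fourier coefficient `coeff · k` as a linear functional. -/
def coeffₗ (k : Fin d → ℤ) : L2 d →ₗ[ℝ] ℂ where
  toFun w := coeff w k
  map_add' v w := coeff_add v w k
  map_smul' c w := coeff_smul c w k

theorem coeff_sub (v w : L2 d) (k : Fin d → ℤ) : coeff (v - w) k = coeff v k - coeff w k :=
  map_sub (coeffₗ k) v w

theorem coeff_zero (k : Fin d → ℤ) : coeff (0 : L2 d) k = 0 := map_zero (coeffₗ k)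

theorem coeff_neg_index (w : L2 d) (k : Fin d → ℤ) :
    coeff w (-k) = (starRingEnd ℂ) (coeff w k) := by
  rw [coeff, coeff, ← integral_conj]
  congr 1
  ext x
  rw [map_mul, Complex.conj_conj, Complex.conj_ofReal, conj_phi, neg_neg]

theorem hasSum_norm_coeff_sq (w : L2 d) : HasSum (fun k => ‖coeff w k‖ ^ 2) (‖w‖ ^ 2) := by
  have parseval := lp.hasSum_norm (p := 2) (by norm_num) ((phiBasis d).repr (toComplex w))
  simpa [phiBasis_repr_toComplex, norm_toComplex] using parseval

theorem ext_coeff {v w : L2 d} (h : ∀ k, coeff v k = coeff w k) : v = w := by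
  have norm_sub_sq : HasSum (fun _ : Fin d → ℤ => (0 : ℝ)) (‖v - w‖ ^ 2) := by
    simpa [coeff_sub, h] using hasSum_norm_coeff_sq (v - w)
  have norm_sq_eq_zero := norm_sub_sq.unique hasSum_zero
  simpa [sub_eq_zero] using norm_sq_eq_zero

theorem integrable_mul_conj_phi (z : Lp ℂ 2 (volume : Measure (Torus d))) (k : Fin d → ℤ) :
    Integrable fun x => z x * (starRingEnd ℂ) (phi k x) := by
  refine ((Lp.memLp z).integrable (by norm_num)).mul_bdd (c := ‖phi k‖)
    (Complex.continuous_conj.comp (phi k).continuous).aestronglyMeasurable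
    (Eventually.of_forall fun x => ?_)
  rw [RCLike.norm_conj]
  exact (phi k).norm_coe_le_norm x

theorem coeff_reLp (z : Lp ℂ 2 (volume : Measure (Torus d))) (k : Fin d → ℤ) :
    coeff (reLp d z) k
      = ((phiBasis d).repr z k + (starRingEnd ℂ) ((phiBasis d).repr z (-k))) / 2 := by
  have integrand : coeff (reLp d z) k
      = ∫ x, (z x * (starRingEnd ℂ) (phi k x)
        + (starRingEnd ℂ) (z x * (starRingEnd ℂ) (phi (-k) x))) / 2 := by
    refine integral_congr_ae ?_
    filter_upwards [coeFn_reLp z] with x hx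
    rw [hx, map_mul, Complex.conj_conj, ← conj_phi, Complex.re_eq_add_conj]
    ring
  have integrable_conj :
      Integrable fun x => (starRingEnd ℂ) (z x * (starRingEnd ℂ) (phi (-k) x)) :=
    Complex.conjCLE.toContinuousLinearMap.integrable_comp (integrable_mul_conj_phi z (-k))
  rw [integrand, integral_div, integral_add (integrable_mul_conj_phi z k) integrable_conj,
    integral_conj, phiBasis_repr_apply, phiBasis_repr_apply]

theorem exists_coeff_eq (c : (Fin d → ℤ) → ℂ) (hc : Summable fun k => ‖c k‖ ^ 2)
    (hsymm : ∀ k, c (-k) = (starRingEnd ℂ) (c k)) : ∃ u : L2 d, ∀ k, coeff u k = c k := by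
  have memlp : Memℓp c 2 := by
    rw [memℓp_gen_iff (by norm_num)]
    simpa using hc
  refine ⟨reLp d ((phiBasis d).repr.symm ⟨c, memlp⟩), fun k => ?_⟩
  rw [coeff_reLp, LinearIsometryEquiv.apply_symm_apply]
  simp [hsymm]

theorem exists_coeff_eq_smul (w : L2 d) (m : (Fin d → ℤ) → ℝ) (hm : ∀ k, m (-k) = m k)
    (hw : Summable fun k => m k ^ 2 * ‖coeff w k‖ ^ 2) :
    ∃ u : L2 d, ∀ k, coeff u k = m k • coeff w k :=
  exists_coeff_eq _ (by simpa [mul_pow] using hw) fun k => by simp [hm, coeff_neg_index]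

end Coefficients

section Sobolev

variable {d : ℕ}

theorem H1.hasSum_norm_sq (w : H1 d) :
    HasSum (fun k => (1 + eigen k) * ‖coeff (H1.incl d w) k‖ ^ 2) (‖w‖ ^ 2) := by
  rw [H1.norm_sq]
  simp only [add_mul, one_mul]
  exact (hasSum_norm_coeff_sq _).add (Summable.hasSum w.2)

theorem H1.ext_coeff {v w : H1 d}
    (h : ∀ k, coeff (H1.incl d v) k = coeff (H1.incl d w) k) : v = w :=
  H1.incl_injective d (BilinearWave.ext_coeff h)

theorem H1.norm_incl_le (w : H1 d) : ‖H1.incl d w‖ ≤ ‖w‖ := by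
  refine le_of_sq_le_sq ?_ (norm_nonneg _)
  exact hasSum_le (fun k => le_mul_of_one_le_left (sq_nonneg _) (by linarith [eigen_nonneg k]))
    (hasSum_norm_coeff_sq _) (H1.hasSum_norm_sq w)

theorem H1.exists_coeff_eq_smul (w : L2 d) (m : (Fin d → ℤ) → ℝ) (hm : ∀ k, m (-k) = m k)
    (hw : Summable fun k => (1 + eigen k) * m k ^ 2 * ‖coeff w k‖ ^ 2) :
    ∃ u : H1 d, ∀ k, coeff (H1.incl d u) k = m k • coeff w k := by
  obtain ⟨u, hu⟩ := BilinearWave.exists_coeff_eq_smul w m hm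
    (hw.of_nonneg_of_le (fun _ => by positivity) fun k => by
      rw [mul_assoc]
      exact le_mul_of_one_le_left (by positivity) (by linarith [eigen_nonneg k]))
  refine ⟨H1.mk u (hw.of_nonneg_of_le (fun k => mul_nonneg (eigen_nonneg k) (sq_nonneg _))
    fun k => ?_), hu⟩
  rw [hu, norm_smul, mul_pow, Real.norm_eq_abs, sq_abs, ← mul_assoc]
  gcongr
  linarith

theorem exists_coeff_eq_inv_sqrt_smul (u : L2 d) :
    ∃ w : H1 d, ∀ k, coeff (H1.incl d w) k = (√(1 + eigen k))⁻¹ • coeff u k := by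
  refine H1.exists_coeff_eq_smul u (fun k => (√(1 + eigen k))⁻¹)
    (fun k => by rw [eigen_neg]) ((hasSum_norm_coeff_sq u).summable.congr fun k => ?_)
  rw [inv_pow, Real.sq_sqrt (one_add_eigen_pos k).le,
    mul_inv_cancel₀ (one_add_eigen_pos k).ne', one_mul]

/-- The Bessel potential `(1 - Δ)^{-1/2} : L² → H¹`, as a linear isometry. It transports statements
about `L²` to `H¹`. -/
def besselPotential (d : ℕ) : L2 d →ₗᵢ[ℝ] H1 d where
  toFun u := (exists_coeff_eq_inv_sqrt_smul u).choose
  map_add' u v := H1.ext_coeff fun k => by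
    rw [map_add, coeff_add]
    iterate 3 rw [(exists_coeff_eq_inv_sqrt_smul _).choose_spec]
    rw [coeff_add, smul_add]
  map_smul' c u := H1.ext_coeff fun k => by
    rw [map_smul, coeff_smul]
    iterate 2 rw [(exists_coeff_eq_inv_sqrt_smul _).choose_spec]
    rw [coeff_smul, RingHom.id_apply, smul_comm]
  norm_map' u := by
    rw [← sq_eq_sq₀ (norm_nonneg _) (norm_nonneg _)]
    refine (H1.hasSum_norm_sq _).unique ((hasSum_norm_coeff_sq u).congr_fun fun k => ?_)
    change (1 + eigen k) * ‖coeff (H1.incl d (exists_coeff_eq_inv_sqrt_smul u).choose) k‖ ^ 2 = _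
    rw [(exists_coeff_eq_inv_sqrt_smul u).choose_spec, norm_smul, mul_pow, Real.norm_eq_abs,
      sq_abs, inv_pow, Real.sq_sqrt (one_add_eigen_pos k).le,
      mul_inv_cancel_left₀ (one_add_eigen_pos k).ne']

theorem coeff_besselPotential (u : L2 d) (k : Fin d → ℤ) :
    coeff (H1.incl d (besselPotential d u)) k = (√(1 + eigen k))⁻¹ • coeff u k :=
  (exists_coeff_eq_inv_sqrt_smul u).choose_spec k

theorem exists_besselPotential_eq (w : H1 d) :
    ∃ u : L2 d, besselPotential d u = w
      ∧ ∀ k, coeff u k = √(1 + eigen k) • coeff (H1.incl d w) k := by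
  obtain ⟨u, hu⟩ := exists_coeff_eq_smul (H1.incl d w) (fun k => √(1 + eigen k))
    (fun k => by rw [eigen_neg]) ((H1.hasSum_norm_sq w).summable.congr fun k => by
      rw [Real.sq_sqrt (one_add_eigen_pos k).le])
  refine ⟨u, H1.ext_coeff fun k => ?_, hu⟩
  rw [coeff_besselPotential, hu, inv_smul_smul₀ (Real.sqrt_pos.2 (one_add_eigen_pos k)).ne']

instance instCompleteSpaceH1 (d : ℕ) : CompleteSpace (H1 d) := by
  have surjective : Function.Surjective (besselPotential d) := fun w =>
    (exists_besselPotential_eq w).imp fun _ h => h.1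
  exact ((besselPotential d).isometry.isUniformInducing.completeSpace_congr surjective).1
    inferInstance

end Sobolev

section Multiplier

variable {d : ℕ} {m : (Fin d → ℤ) → ℝ}

theorem reLp_smul_phiLp (w : L2 d) (k : Fin d → ℤ) :
    reLp d (coeff w k • phiLp k) = part w k := by
  refine Lp.ext ?_
  filter_upwards [coeFn_reLp (coeff w k • phiLp k), Lp.coeFn_smul (coeff w k) (phiLp k),
    coeFn_phiLp k, ContinuousMap.coeFn_toLp (p := 2) (𝕜 := ℝ) (volume : Measure (Torus d))
      (⟨fun x => (coeff w k * phi k x).re, by fun_prop⟩ : C(Torus d, ℝ))] with x hre hsmul hphi hx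
  rw [hre, hsmul, Pi.smul_apply, hphi, part, hx]
  rfl

theorem hasSum_part {w u : L2 d} (hu : ∀ k, coeff u k = m k • coeff w k) :
    HasSum (fun k => m k • part w k) u := by
  have expansion := ((phiBasis d).hasSum_repr (toComplex u)).mapL (reLp d)
  rw [reLp_toComplex] at expansion
  refine expansion.congr_fun fun k => ?_
  rw [phiBasis_repr_toComplex, hu, phiBasis, HilbertBasis.coe_mk, smul_assoc, map_smul,
    reLp_smul_phiLp]

theorem besselPotential_part (w : L2 d) (k : Fin d → ℤ) :
    besselPotential d (part w k) = (√(1 + eigen k))⁻¹ • partH1 w k := by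
  refine H1.ext_coeff fun j => ?_
  rw [coeff_besselPotential, map_smul, coeff_smul]
  change _ = (√(1 + eigen k))⁻¹ • coeff (part w k) j
  by_cases hj : k = j
  · rw [hj]
  by_cases hneg : -k = j
  · rw [← hneg, eigen_neg]
  · rw [coeff_part_eq_zero w hj hneg, smul_zero, smul_zero]

theorem hasSum_partH1 {w : L2 d} {u : H1 d} (hu : ∀ k, coeff (H1.incl d u) k = m k • coeff w k) :
    HasSum (fun k => m k • partH1 w k) u := by
  obtain ⟨v, rfl, hv⟩ := exists_besselPotential_eq u
  have sum_v : HasSum (fun k => (√(1 + eigen k) * m k) • part w k) v :=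
    hasSum_part fun k => by rw [hv, hu, smul_smul]
  refine (sum_v.mapL (besselPotential d).toContinuousLinearMap).congr_fun fun k => ?_
  rw [map_smul, mul_comm, mul_smul]
  change _ = m k • √(1 + eigen k) • besselPotential d (part w k)
  rw [besselPotential_part, smul_inv_smul₀ (Real.sqrt_pos.2 (one_add_eigen_pos k)).ne']

theorem exists_hasSum_part (w : L2 d) (hm : ∀ k, m (-k) = m k)
    (hw : Summable fun k => m k ^ 2 * ‖coeff w k‖ ^ 2) :
    ∃ u : L2 d, HasSum (fun k => m k • part w k) u ∧ ∀ k, coeff u k = m k • coeff w k :=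
  (exists_coeff_eq_smul w m hm hw).imp fun _ hu => ⟨hasSum_part hu, hu⟩

theorem exists_hasSum_partH1 (w : L2 d) (hm : ∀ k, m (-k) = m k)
    (hw : Summable fun k => (1 + eigen k) * m k ^ 2 * ‖coeff w k‖ ^ 2) :
    ∃ u : H1 d, HasSum (fun k => m k • partH1 w k) u
      ∧ ∀ k, coeff (H1.incl d u) k = m k • coeff w k :=
  (H1.exists_coeff_eq_smul w m hm hw).imp fun _ hu => ⟨hasSum_partH1 hu, hu⟩

end Multiplier

section DominatedConvergence

theorem tendsto_zero_of_hasSum_norm_sq {E ι κ : Type*} [SeminormedAddCommGroup E]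
    {l : Filter ι} {z : ι → E} {F : ι → κ → ℝ} {G : κ → ℝ}
    (hF : ∀ i, HasSum (F i) (‖z i‖ ^ 2)) (hG : Summable G)
    (hle : ∀ᶠ i in l, ∀ k, ‖F i k‖ ≤ G k)
    (hlim : ∀ k, Tendsto (fun i => F i k) l (𝓝 0)) : Tendsto z l (𝓝 0) := by
  have norm_sq := tendsto_tsum_of_dominated_convergence hG hlim hle
  simp only [tsum_zero, (hF _).tsum_eq] at norm_sq
  rw [tendsto_zero_iff_norm_tendsto_zero]
  simpa [Real.sqrt_sq] using norm_sq.sqrt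

variable {d : ℕ} {ι : Type*} {l : Filter ι} {G : (Fin d → ℤ) → ℝ}

theorem tendsto_zero_of_coeff {z : ι → L2 d} (hG : Summable G)
    (hle : ∀ᶠ i in l, ∀ k, ‖coeff (z i) k‖ ^ 2 ≤ G k)
    (hlim : ∀ k, Tendsto (fun i => coeff (z i) k) l (𝓝 0)) : Tendsto z l (𝓝 0) :=
  tendsto_zero_of_hasSum_norm_sq (fun i => hasSum_norm_coeff_sq (z i)) hG
    (hle.mono fun i hi k => by simpa using hi k) fun k => by simpa using (hlim k).norm.pow 2

theorem H1.tendsto_zero_of_coeff {z : ι → H1 d} (hG : Summable G)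
    (hle : ∀ᶠ i in l, ∀ k, (1 + eigen k) * ‖coeff (H1.incl d (z i)) k‖ ^ 2 ≤ G k)
    (hlim : ∀ k, Tendsto (fun i => coeff (H1.incl d (z i)) k) l (𝓝 0)) : Tendsto z l (𝓝 0) :=
  tendsto_zero_of_hasSum_norm_sq (fun i => H1.hasSum_norm_sq (z i)) hG
    (hle.mono fun i hi k => by
      rw [Real.norm_of_nonneg (mul_nonneg (one_add_eigen_pos k).le (sq_nonneg _))]
      exact hi k)
    fun k => by simpa using ((hlim k).norm.pow 2).const_mul (1 + eigen k)

end DominatedConvergence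

section MultiplierBounds

theorem norm_le_of_hasSum_norm_sq_le {E F ι : Type*} [SeminormedAddCommGroup E]
    [SeminormedAddCommGroup F] {u : E} {w : F} {f g : ι → ℝ} {C : ℝ} (hC : 0 ≤ C)
    (hf : HasSum f (‖u‖ ^ 2)) (hg : HasSum g (‖w‖ ^ 2)) (h : ∀ k, f k ≤ C ^ 2 * g k) :
    ‖u‖ ≤ C * ‖w‖ := by
  refine le_of_sq_le_sq ?_ (by positivity)
  rw [mul_pow]
  exact hasSum_le h hf (hg.mul_left _)

variable {d : ℕ} {m : (Fin d → ℤ) → ℝ} {C : ℝ}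

theorem norm_smul_sq (a : ℝ) (z : ℂ) : ‖a • z‖ ^ 2 = a ^ 2 * ‖z‖ ^ 2 := by
  rw [norm_smul, mul_pow, Real.norm_eq_abs, sq_abs]

theorem norm_le_of_coeff_eq_smul {u w : L2 d} (hC : 0 ≤ C)
    (hu : ∀ k, coeff u k = m k • coeff w k) (hm : ∀ k, |m k| ≤ C) : ‖u‖ ≤ C * ‖w‖ := by
  refine norm_le_of_hasSum_norm_sq_le hC (hasSum_norm_coeff_sq u) (hasSum_norm_coeff_sq w)
    fun k => ?_
  rw [hu, norm_smul_sq]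
  exact mul_le_mul_of_nonneg_right (sq_le_sq' (abs_le.1 (hm k)).1 (abs_le.1 (hm k)).2) (sq_nonneg _)

theorem H1.norm_le_of_coeff_eq_smul {u w : H1 d} (hC : 0 ≤ C)
    (hu : ∀ k, coeff (H1.incl d u) k = m k • coeff (H1.incl d w) k) (hm : ∀ k, |m k| ≤ C) :
    ‖u‖ ≤ C * ‖w‖ := by
  refine norm_le_of_hasSum_norm_sq_le hC (H1.hasSum_norm_sq u) (H1.hasSum_norm_sq w) fun k => ?_
  rw [hu, norm_smul_sq, mul_left_comm]
  exact mul_le_mul_of_nonneg_right (sq_le_sq' (abs_le.1 (hm k)).1 (abs_le.1 (hm k)).2)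
    (mul_nonneg (one_add_eigen_pos k).le (sq_nonneg _))

theorem H1.norm_le_of_coeff_eq_smul_L2 {u : H1 d} {w : L2 d} (hC : 0 ≤ C)
    (hu : ∀ k, coeff (H1.incl d u) k = m k • coeff w k)
    (hm : ∀ k, (1 + eigen k) * m k ^ 2 ≤ C ^ 2) : ‖u‖ ≤ C * ‖w‖ := by
  refine norm_le_of_hasSum_norm_sq_le hC (H1.hasSum_norm_sq u) (hasSum_norm_coeff_sq w)
    fun k => ?_
  rw [hu, norm_smul_sq, ← mul_assoc]
  gcongr
  exact hm k

theorem norm_le_of_coeff_eq_smul_H1 {u : L2 d} {w : H1 d} (hC : 0 ≤ C)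
    (hu : ∀ k, coeff u k = m k • coeff (H1.incl d w) k) (hm : ∀ k, |m k| ≤ C * √(eigen k)) :
    ‖u‖ ≤ C * ‖w‖ := by
  refine norm_le_of_hasSum_norm_sq_le hC (hasSum_norm_coeff_sq u) (H1.hasSum_norm_sq w)
    fun k => ?_
  rw [hu, norm_smul_sq, ← mul_assoc]
  gcongr
  calc m k ^ 2 ≤ (C * √(eigen k)) ^ 2 := sq_le_sq' (abs_le.1 (hm k)).1 (abs_le.1 (hm k)).2
    _ = C ^ 2 * eigen k := by rw [mul_pow, Real.sq_sqrt (eigen_nonneg k)]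
    _ ≤ C ^ 2 * (1 + eigen k) := by gcongr; linarith

theorem tendsto_zero_of_coeff_eq_smul {ι : Type*} {l : Filter ι} {z : ι → L2 d} {w : L2 d}
    {m : ι → (Fin d → ℤ) → ℝ} (hz : ∀ᶠ i in l, ∀ k, coeff (z i) k = m i k • coeff w k)
    (hm : ∀ i k, m i k ^ 2 ≤ C) (hlim : ∀ k, Tendsto (fun i => m i k) l (𝓝 0)) :
    Tendsto z l (𝓝 0) := by
  refine tendsto_zero_of_coeff ((hasSum_norm_coeff_sq w).summable.mul_left C)
    (hz.mono fun i hi k => ?_) fun k => ?_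
  · rw [hi, norm_smul_sq]
    exact mul_le_mul_of_nonneg_right (hm i k) (sq_nonneg _)
  · rw [← zero_smul ℝ (coeff w k)]
    exact ((hlim k).smul_const _).congr' (hz.mono fun i hi => (hi k).symm)

end MultiplierBounds

/-! ### The free evolution -/

section FreeFlow

variable {d : ℕ}

theorem eigen_zero : eigen (0 : Fin d → ℤ) = 0 := by simp [eigen]

theorem sinc_neg_index (t : ℝ) (k : Fin d → ℤ) : sinc t (-k) = sinc t k := by
  simp [sinc, eigen_neg]

theorem sqrt_eigen_pos {k : Fin d → ℤ} (hk : k ≠ 0) : 0 < √(eigen k) :=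
  Real.sqrt_pos.2 (zero_lt_one.trans_le (one_le_eigen hk))

theorem sqrt_eigen_mul_sinc (t : ℝ) (k : Fin d → ℤ) :
    √(eigen k) * sinc t k = Real.sin (√(eigen k) * t) := by
  by_cases hk : k = 0
  · simp [hk, eigen_zero]
  · rw [sinc, if_neg hk, mul_div_cancel₀ _ (sqrt_eigen_pos hk).ne']

theorem sinc_eq_mul (t : ℝ) (k : Fin d → ℤ) : sinc t k = t * Real.sinc (√(eigen k) * t) := by
  by_cases hk : k = 0
  · simp [hk, sinc, eigen_zero]
  · rcases eq_or_ne t 0 with rfl | ht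
    · simp [sinc, hk]
    · have h := (sqrt_eigen_pos hk).ne'
      rw [sinc, if_neg hk, Real.sinc_of_ne_zero (mul_ne_zero h ht)]
      field_simp

theorem sinc_add (s t : ℝ) (k : Fin d → ℤ) :
    sinc (s + t) k
      = Real.cos (√(eigen k) * s) * sinc t k + sinc s k * Real.cos (√(eigen k) * t) := by
  by_cases hk : k = 0
  · simp [hk, sinc, eigen_zero, add_comm]
  · simp only [sinc, if_neg hk, mul_add, Real.sin_add]
    ring

theorem abs_sinc_le (t : ℝ) (k : Fin d → ℤ) : |sinc t k| ≤ |t| := by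
  rw [sinc_eq_mul, abs_mul]
  exact mul_le_of_le_one_right (abs_nonneg _) (Real.abs_sinc_le_one _)

theorem one_add_eigen_mul_sinc_sq_le (t : ℝ) (k : Fin d → ℤ) :
    (1 + eigen k) * sinc t k ^ 2 ≤ (1 + |t|) ^ 2 := by
  have hsinc : sinc t k ^ 2 ≤ t ^ 2 := sq_le_sq.2 (abs_sinc_le t k)
  have hsin : eigen k * sinc t k ^ 2 = Real.sin (√(eigen k) * t) ^ 2 := by
    rw [← sqrt_eigen_mul_sinc, mul_pow, Real.sq_sqrt (eigen_nonneg k)]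
  nlinarith [Real.sin_sq_le_one (√(eigen k) * t), abs_nonneg t, sq_abs t]

theorem abs_sqrt_eigen_mul_sin_le (t : ℝ) (k : Fin d → ℤ) :
    |-(√(eigen k) * Real.sin (√(eigen k) * t))| ≤ √(eigen k) := by
  rw [abs_neg, abs_mul, abs_of_nonneg (Real.sqrt_nonneg _)]
  exact mul_le_of_le_one_right (Real.sqrt_nonneg _) (Real.abs_sin_le_one _)

theorem abs_cos_sub_one_le (x : ℝ) : |Real.cos x - 1| ≤ |x| := by
  simpa using Real.abs_cos_sub_cos_le x 0

theorem cos_sub_one_sq_le (x : ℝ) : (Real.cos x - 1) ^ 2 ≤ 4 := by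
  nlinarith [Real.cos_le_one x, Real.neg_one_le_cos x]

theorem coeff_freeFlow_fst (t : ℝ) (W : H1 d × L2 d) (k : Fin d → ℤ) :
    coeff (H1.incl d (freeFlow t W).1) k
      = Real.cos (√(eigen k) * t) • coeff (H1.incl d W.1) k + sinc t k • coeff W.2 k := by
  obtain ⟨u, hsum_u, hu⟩ := exists_hasSum_partH1 (m := fun k => Real.cos (√(eigen k) * t))
    (H1.incl d W.1) (fun k => by rw [eigen_neg])
    ((H1.hasSum_norm_sq W.1).summable.of_nonneg_of_le
      (fun k => by have := one_add_eigen_pos k; positivity) fun k => by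
      rw [mul_right_comm]
      exact mul_le_of_le_one_right (by have := one_add_eigen_pos k; positivity)
        (Real.cos_sq_le_one _))
  obtain ⟨v, hsum_v, hv⟩ := exists_hasSum_partH1 (m := sinc t) W.2 (sinc_neg_index t)
    (((hasSum_norm_coeff_sq W.2).summable.mul_left _).of_nonneg_of_le
      (fun k => by have := one_add_eigen_pos k; positivity)
      fun k => mul_le_mul_of_nonneg_right (one_add_eigen_mul_sinc_sq_le t k) (sq_nonneg _))
  have hflow : (freeFlow t W).1 = u + v := (hsum_u.add hsum_v).tsum_eq
  rw [hflow, map_add, coeff_add, hu, hv]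

theorem coeff_freeFlow_snd (t : ℝ) (W : H1 d × L2 d) (k : Fin d → ℤ) :
    coeff (freeFlow t W).2 k
      = -(√(eigen k) * Real.sin (√(eigen k) * t)) • coeff (H1.incl d W.1) k
        + Real.cos (√(eigen k) * t) • coeff W.2 k := by
  obtain ⟨u, hsum_u, hu⟩ := exists_hasSum_part
    (m := fun k => -(√(eigen k) * Real.sin (√(eigen k) * t))) (H1.incl d W.1)
    (fun k => by rw [eigen_neg])
    ((H1.hasSum_norm_sq W.1).summable.of_nonneg_of_le (fun k => by positivity) fun k => by
      gcongr
      refine (sq_le_sq.2 ((abs_sqrt_eigen_mul_sin_le t k).trans (le_abs_self _))).trans ?_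
      rw [Real.sq_sqrt (eigen_nonneg k)]
      linarith)
  obtain ⟨v, hsum_v, hv⟩ := exists_hasSum_part (m := fun k => Real.cos (√(eigen k) * t)) W.2
    (fun k => by rw [eigen_neg])
    ((hasSum_norm_coeff_sq W.2).summable.of_nonneg_of_le (fun k => by positivity) fun k =>
      mul_le_of_le_one_left (sq_nonneg _) (Real.cos_sq_le_one _))
  have hflow : (freeFlow t W).2 = u + v := (hsum_u.add hsum_v).tsum_eq
  rw [hflow, coeff_add, hu, hv]

theorem ext_coeff_prod {V W : H1 d × L2 d}
    (hfst : ∀ k, coeff (H1.incl d V.1) k = coeff (H1.incl d W.1) k)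
    (hsnd : ∀ k, coeff V.2 k = coeff W.2 k) : V = W :=
  Prod.ext (H1.ext_coeff hfst) (ext_coeff hsnd)

theorem freeFlow_add (t : ℝ) (V W : H1 d × L2 d) :
    freeFlow t (V + W) = freeFlow t V + freeFlow t W := by
  refine ext_coeff_prod (fun k => ?_) fun k => ?_
  · simp only [Prod.fst_add, Prod.snd_add, map_add, coeff_add, coeff_freeFlow_fst, smul_add]
    ring
  · simp only [Prod.fst_add, Prod.snd_add, map_add, coeff_add, coeff_freeFlow_snd, smul_add]
    ring

theorem freeFlow_smul (t c : ℝ) (W : H1 d × L2 d) :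
    freeFlow t (c • W) = c • freeFlow t W := by
  refine ext_coeff_prod (fun k => ?_) fun k => ?_
  · simp only [Prod.smul_fst, Prod.smul_snd, map_smul, coeff_smul, coeff_freeFlow_fst, smul_add]
    rw [smul_comm c, smul_comm c]
  · simp only [Prod.smul_fst, Prod.smul_snd, map_smul, coeff_smul, coeff_freeFlow_snd, smul_add]
    rw [smul_comm c, smul_comm c]

theorem freeFlow_freeFlow (s t : ℝ) (W : H1 d × L2 d) :
    freeFlow (s + t) W = freeFlow s (freeFlow t W) := by
  refine ext_coeff_prod (fun k => ?_) fun k => ?_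
  · simp only [coeff_freeFlow_fst, coeff_freeFlow_snd, sinc_add, mul_add, Real.cos_add,
      ← sqrt_eigen_mul_sinc]
    module
  · have hsin : Real.sin (√(eigen k) * t) = √(eigen k) * sinc t k :=
      (sqrt_eigen_mul_sinc t k).symm
    simp only [coeff_freeFlow_fst, coeff_freeFlow_snd, mul_add, Real.cos_add, Real.sin_add, hsin]
    module

theorem freeFlow_eq_add (t : ℝ) (W : H1 d × L2 d) :
    freeFlow t W = freeFlow t (W.1, 0) + freeFlow t (0, W.2) := by
  rw [← freeFlow_add]; simp

theorem coeff_freeFlow_profile_fst (t : ℝ) (w : H1 d) (k : Fin d → ℤ) :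
    coeff (H1.incl d (freeFlow t (w, 0)).1) k
      = Real.cos (√(eigen k) * t) • coeff (H1.incl d w) k := by
  rw [coeff_freeFlow_fst, coeff_zero, smul_zero, add_zero]

theorem coeff_freeFlow_profile_fst_sub (t : ℝ) (w : H1 d) (k : Fin d → ℤ) :
    coeff (H1.incl d ((freeFlow t (w, 0)).1 - w)) k
      = (Real.cos (√(eigen k) * t) - 1) • coeff (H1.incl d w) k := by
  rw [map_sub, coeff_sub, coeff_freeFlow_profile_fst, sub_smul, one_smul]

theorem coeff_freeFlow_profile_snd (t : ℝ) (w : H1 d) (k : Fin d → ℤ) :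
    coeff (freeFlow t (w, 0)).2 k
      = -(√(eigen k) * Real.sin (√(eigen k) * t)) • coeff (H1.incl d w) k := by
  rw [coeff_freeFlow_snd, coeff_zero, smul_zero, add_zero]

theorem coeff_freeFlow_velocity_fst (t : ℝ) (v : L2 d) (k : Fin d → ℤ) :
    coeff (H1.incl d (freeFlow t (0, v)).1) k = sinc t k • coeff v k := by
  rw [coeff_freeFlow_fst, map_zero, coeff_zero, smul_zero, zero_add]

theorem coeff_freeFlow_velocity_snd (t : ℝ) (v : L2 d) (k : Fin d → ℤ) :
    coeff (freeFlow t (0, v)).2 k = Real.cos (√(eigen k) * t) • coeff v k := by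
  rw [coeff_freeFlow_snd, map_zero, coeff_zero, smul_zero, zero_add]

theorem coeff_freeFlow_velocity_snd_sub (t : ℝ) (v : L2 d) (k : Fin d → ℤ) :
    coeff ((freeFlow t (0, v)).2 - v) k = (Real.cos (√(eigen k) * t) - 1) • coeff v k := by
  rw [coeff_sub, coeff_freeFlow_velocity_snd, sub_smul, one_smul]

theorem norm_freeFlow_profile_le (t : ℝ) (w : H1 d) : ‖freeFlow t (w, 0)‖ ≤ ‖w‖ := by
  rw [← one_mul ‖w‖]
  refine max_le ?_ ?_
  · exact H1.norm_le_of_coeff_eq_smul zero_le_one (coeff_freeFlow_profile_fst t w)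
      fun k => Real.abs_cos_le_one _
  · exact norm_le_of_coeff_eq_smul_H1 zero_le_one (coeff_freeFlow_profile_snd t w)
      fun k => (one_mul √(eigen k)).symm ▸ abs_sqrt_eigen_mul_sin_le t k

theorem norm_freeFlow_velocity_le (t : ℝ) (v : L2 d) : ‖freeFlow t (0, v)‖ ≤ (1 + |t|) * ‖v‖ := by
  refine max_le ?_ ?_
  · exact H1.norm_le_of_coeff_eq_smul_L2 (by positivity) (coeff_freeFlow_velocity_fst t v)
      (one_add_eigen_mul_sinc_sq_le t)
  · exact norm_le_of_coeff_eq_smul (by positivity) (coeff_freeFlow_velocity_snd t v)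
      fun k => (Real.abs_cos_le_one _).trans (le_add_of_nonneg_right (abs_nonneg t))

/-- The free evolution as a bounded operator. -/
def freeFlowL (d : ℕ) (t : ℝ) : (H1 d × L2 d) →L[ℝ] (H1 d × L2 d) :=
  LinearMap.mkContinuous
    { toFun := freeFlow t
      map_add' := freeFlow_add t
      map_smul' := freeFlow_smul t } (2 + |t|) fun W => by
    change ‖freeFlow t W‖ ≤ _
    calc ‖freeFlow t W‖ ≤ ‖W.1‖ + (1 + |t|) * ‖W.2‖ := by
          rw [freeFlow_eq_add]
          exact (norm_add_le _ _).trans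
            (add_le_add (norm_freeFlow_profile_le t _) (norm_freeFlow_velocity_le t _))
      _ ≤ ‖W‖ + (1 + |t|) * ‖W‖ := by
          gcongr
          exacts [norm_fst_le W, norm_snd_le W]
      _ = (2 + |t|) * ‖W‖ := by ring

theorem norm_freeFlowL_le (t : ℝ) : ‖freeFlowL d t‖ ≤ 2 + |t| :=
  LinearMap.mkContinuous_norm_le _ (by positivity) _

theorem norm_incl_freeFlow_profile_sub_le (t : ℝ) (w : H1 d) :
    ‖H1.incl d ((freeFlow t (w, 0)).1 - w)‖ ≤ |t| * ‖w‖ := by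
  refine norm_le_of_coeff_eq_smul_H1 (abs_nonneg t) (coeff_freeFlow_profile_fst_sub t w)
    fun k => (abs_cos_sub_one_le _).trans_eq ?_
  rw [abs_mul, abs_of_nonneg (Real.sqrt_nonneg _), mul_comm]

theorem norm_incl_freeFlow_velocity_le (t : ℝ) (v : L2 d) :
    ‖H1.incl d (freeFlow t (0, v)).1‖ ≤ |t| * ‖v‖ :=
  norm_le_of_coeff_eq_smul (abs_nonneg t) (coeff_freeFlow_velocity_fst t v) (abs_sinc_le t)

theorem norm_incl_freeFlow_fst_sub_le (t : ℝ) (W : H1 d × L2 d) :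
    ‖H1.incl d ((freeFlow t W).1 - W.1)‖ ≤ |t| * (‖W.1‖ + ‖W.2‖) := by
  rw [freeFlow_eq_add, Prod.fst_add, add_sub_right_comm, map_add, mul_add]
  exact (norm_add_le _ _).trans (add_le_add (norm_incl_freeFlow_profile_sub_le _ _)
    (norm_incl_freeFlow_velocity_le _ _))

theorem norm_freeFlow_velocity_sub_le (t : ℝ) (g : H1 d) :
    ‖freeFlow t (0, H1.incl d g) - (0, H1.incl d g)‖ ≤ |t| * ‖g‖ := by
  refine max_le ?_ ?_
  · rw [Prod.fst_sub, sub_zero]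
    exact H1.norm_le_of_coeff_eq_smul (abs_nonneg t) (coeff_freeFlow_velocity_fst t _)
      (abs_sinc_le t)
  · refine norm_le_of_coeff_eq_smul_H1 (abs_nonneg t) (coeff_freeFlow_velocity_snd_sub t _)
      fun k => (abs_cos_sub_one_le _).trans_eq ?_
    rw [abs_mul, abs_of_nonneg (Real.sqrt_nonneg _), mul_comm]

theorem tendsto_inv_smul_freeFlow_velocity (v : L2 d) :
    Tendsto (fun t : ℝ => t⁻¹ • H1.incl d (freeFlow t (0, v)).1) (𝓝[≠] 0) (𝓝 v) := by
  rw [← tendsto_sub_nhds_zero_iff]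
  refine tendsto_zero_of_coeff_eq_smul (w := v) (C := 4)
    (m := fun t k => Real.sinc (√(eigen k) * t) - 1) ?_ (fun t k => ?_) fun k => ?_
  · filter_upwards [self_mem_nhdsWithin] with t ht k
    rw [coeff_sub, coeff_smul, coeff_freeFlow_velocity_fst, smul_smul, sinc_eq_mul,
      inv_mul_cancel_left₀ ht, sub_smul, one_smul]
  · have := abs_le.1 (Real.abs_sinc_le_one (√(eigen k) * t))
    nlinarith
  · have hc : Continuous fun t : ℝ => Real.sinc (√(eigen k) * t) - 1 := by fun_prop
    simpa using (hc.tendsto 0).mono_left (nhdsWithin_le_nhds (s := {0}ᶜ))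

theorem tendsto_cos_sqrt_eigen_sub_one (k : Fin d → ℤ) :
    Tendsto (fun t : ℝ => Real.cos (√(eigen k) * t) - 1) (𝓝 0) (𝓝 0) := by
  have hc : Continuous fun t : ℝ => Real.cos (√(eigen k) * t) - 1 := by fun_prop
  simpa using hc.tendsto 0

theorem tendsto_freeFlow_profile_fst (w : H1 d) :
    Tendsto (fun t : ℝ => (freeFlow t (w, 0)).1) (𝓝 0) (𝓝 w) := by
  rw [← tendsto_sub_nhds_zero_iff]
  refine H1.tendsto_zero_of_coeff ((H1.hasSum_norm_sq w).summable.mul_left 4)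
    (Eventually.of_forall fun t k => ?_) fun k => ?_
  · rw [coeff_freeFlow_profile_fst_sub, norm_smul_sq, mul_left_comm]
    have := one_add_eigen_pos k
    exact mul_le_mul_of_nonneg_right (cos_sub_one_sq_le _) (by positivity)
  · simp only [coeff_freeFlow_profile_fst_sub]
    simpa using (tendsto_cos_sqrt_eigen_sub_one k).smul_const (coeff (H1.incl d w) k)

theorem tendsto_freeFlow_profile_snd (w : H1 d) :
    Tendsto (fun t : ℝ => (freeFlow t (w, 0)).2) (𝓝 0) (𝓝 0) := by
  refine tendsto_zero_of_coeff (H1.hasSum_norm_sq w).summable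
    (Eventually.of_forall fun t k => ?_) fun k => ?_
  · rw [coeff_freeFlow_profile_snd, norm_smul_sq]
    gcongr
    refine (sq_le_sq.2 ((abs_sqrt_eigen_mul_sin_le t k).trans (le_abs_self _))).trans ?_
    rw [Real.sq_sqrt (eigen_nonneg k)]
    linarith
  · have hc : Continuous fun t : ℝ =>
        -(√(eigen k) * Real.sin (√(eigen k) * t)) • coeff (H1.incl d w) k := by fun_prop
    simpa [coeff_freeFlow_profile_snd] using hc.tendsto 0

theorem tendsto_freeFlow_velocity_fst (v : L2 d) :
    Tendsto (fun t : ℝ => (freeFlow t (0, v)).1) (𝓝 0) (𝓝 0) := by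
  refine H1.tendsto_zero_of_coeff ((hasSum_norm_coeff_sq v).summable.mul_left 4) ?_ fun k => ?_
  · filter_upwards [Metric.ball_mem_nhds (0 : ℝ) one_pos] with t ht k
    rw [mem_ball_zero_iff, Real.norm_eq_abs] at ht
    rw [coeff_freeFlow_velocity_fst, norm_smul_sq, ← mul_assoc]
    refine mul_le_mul_of_nonneg_right ?_ (sq_nonneg _)
    nlinarith [one_add_eigen_mul_sinc_sq_le t k, abs_nonneg t]
  · have hc : Continuous fun t : ℝ => (t * Real.sinc (√(eigen k) * t)) • coeff v k := by fun_prop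
    simpa [coeff_freeFlow_velocity_fst, sinc_eq_mul] using hc.tendsto 0

theorem tendsto_freeFlow_velocity_snd (v : L2 d) :
    Tendsto (fun t : ℝ => (freeFlow t (0, v)).2) (𝓝 0) (𝓝 v) := by
  rw [← tendsto_sub_nhds_zero_iff]
  exact tendsto_zero_of_coeff_eq_smul
    (Eventually.of_forall fun t => coeff_freeFlow_velocity_snd_sub t v)
    (fun t k => cos_sub_one_sq_le _) tendsto_cos_sqrt_eigen_sub_one

theorem tendsto_freeFlow_zero (W : H1 d × L2 d) :
    Tendsto (fun t : ℝ => freeFlow t W) (𝓝 0) (𝓝 W) := by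
  have hlim := ((tendsto_freeFlow_profile_fst W.1).prodMk_nhds
    (tendsto_freeFlow_profile_snd W.1)).add
    ((tendsto_freeFlow_velocity_fst W.2).prodMk_nhds (tendsto_freeFlow_velocity_snd W.2))
  rw [Prod.mk_add_mk, add_zero, zero_add] at hlim
  exact hlim.congr fun t => (freeFlow_eq_add t W).symm

theorem isStrongGroup_freeFlowL (d : ℕ) : IsStrongGroup (freeFlowL d) :=
  .of_tendsto (by fun_prop) norm_freeFlowL_le freeFlow_freeFlow tendsto_freeFlow_zero

end FreeFlow

/-! ### Multiplication operators and kicks -/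

section Multiplication

variable {d : ℕ}

theorem coeFn_mulL2 (m : C(Torus d, ℝ)) (w : L2 d) :
    mulL2 m w =ᵐ[volume] fun x => m x * w x := MemLp.coeFn_toLp _

theorem mulL2_add_left (m n : C(Torus d, ℝ)) (w : L2 d) :
    mulL2 (m + n) w = mulL2 m w + mulL2 n w := by
  refine Lp.ext ?_
  filter_upwards [coeFn_mulL2 (m + n) w, coeFn_mulL2 m w, coeFn_mulL2 n w,
    Lp.coeFn_add (mulL2 m w) (mulL2 n w)] with x hmn hm hn hadd
  rw [hadd, hmn, Pi.add_apply, hm, hn, ContinuousMap.add_apply, add_mul]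

theorem mulL2_smul_left (c : ℝ) (m : C(Torus d, ℝ)) (w : L2 d) :
    mulL2 (c • m) w = c • mulL2 m w := by
  refine Lp.ext ?_
  filter_upwards [coeFn_mulL2 (c • m) w, coeFn_mulL2 m w, Lp.coeFn_smul c (mulL2 m w)]
    with x hcm hm hsmul
  rw [hsmul, hcm, Pi.smul_apply, hm, ContinuousMap.smul_apply, smul_mul_assoc]

theorem mulL2_add_right (m : C(Torus d, ℝ)) (v w : L2 d) :
    mulL2 m (v + w) = mulL2 m v + mulL2 m w := by
  refine Lp.ext ?_
  filter_upwards [coeFn_mulL2 m (v + w), coeFn_mulL2 m v, coeFn_mulL2 m w, Lp.coeFn_add v w,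
    Lp.coeFn_add (mulL2 m v) (mulL2 m w)] with x hvw hv hw hadd hadd'
  rw [hadd', hvw, hadd, Pi.add_apply, Pi.add_apply, hv, hw, mul_add]

theorem mulL2_smul_right (c : ℝ) (m : C(Torus d, ℝ)) (w : L2 d) :
    mulL2 m (c • w) = c • mulL2 m w := by
  refine Lp.ext ?_
  filter_upwards [coeFn_mulL2 m (c • w), coeFn_mulL2 m w, Lp.coeFn_smul c w,
    Lp.coeFn_smul c (mulL2 m w)] with x hcw hw hsmul hsmul'
  rw [hsmul', hcw, hsmul, Pi.smul_apply, Pi.smul_apply, hw, mul_smul_comm]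

theorem mulL2_mul (m n : C(Torus d, ℝ)) (w : L2 d) : mulL2 (m * n) w = mulL2 m (mulL2 n w) := by
  refine Lp.ext ?_
  filter_upwards [coeFn_mulL2 (m * n) w, coeFn_mulL2 m (mulL2 n w), coeFn_mulL2 n w]
    with x hmn hm hn
  rw [hmn, hm, hn, ContinuousMap.mul_apply, mul_assoc]

theorem norm_mulL2_le (m : C(Torus d, ℝ)) (w : L2 d) : ‖mulL2 m w‖ ≤ ‖m‖ * ‖w‖ := by
  refine Lp.norm_le_mul_norm_of_ae_le_mul ?_
  filter_upwards [coeFn_mulL2 m w] with x hx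
  rw [hx, norm_mul]
  exact mul_le_mul_of_nonneg_right (m.norm_coe_le_norm x) (norm_nonneg _)

/-- Multiplication by a continuous function, as a bounded operator. -/
def mulL (m : C(Torus d, ℝ)) : L2 d →L[ℝ] L2 d :=
  LinearMap.mkContinuous
    { toFun := mulL2 m
      map_add' := mulL2_add_right m
      map_smul' := fun c w => mulL2_smul_right c m w } ‖m‖ (norm_mulL2_le m)

@[simp]
theorem mulL_apply (m : C(Torus d, ℝ)) (w : L2 d) : mulL m w = mulL2 m w := rfl

/-- The inclusion `H¹ → L²` as a bounded operator. -/
def inclL (d : ℕ) : H1 d →L[ℝ] L2 d :=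
  LinearMap.mkContinuous (H1.incl d) 1 fun w => (one_mul ‖w‖).symm ▸ H1.norm_incl_le w

/-- The operator `m B`, with `B (w, v) = (0, w)`, as a linear function of `m`. -/
def kick (d : ℕ) : C(Torus d, ℝ) →ₗ[ℝ] ((H1 d × L2 d) →L[ℝ] (H1 d × L2 d)) where
  toFun m := (ContinuousLinearMap.inr ℝ (H1 d) (L2 d)).comp
    ((mulL m).comp ((inclL d).comp (ContinuousLinearMap.fst ℝ (H1 d) (L2 d))))
  map_add' m n := ContinuousLinearMap.ext fun _ =>
    Prod.ext (add_zero (0 : H1 d)).symm (mulL2_add_left m n _)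
  map_smul' c m := ContinuousLinearMap.ext fun _ =>
    Prod.ext (smul_zero c (A := H1 d)).symm (mulL2_smul_left c m _)

theorem kick_apply (m : C(Torus d, ℝ)) (W : H1 d × L2 d) :
    kick d m W = (0, mulL2 m (H1.incl d W.1)) := rfl

theorem kick_kick (m n : C(Torus d, ℝ)) (W : H1 d × L2 d) : kick d m (kick d n W) = 0 := by
  rw [kick_apply, kick_apply, map_zero, ← mulL_apply, map_zero, Prod.mk_zero_zero]

theorem norm_kick_le (m : C(Torus d, ℝ)) (W : H1 d × L2 d) :
    ‖kick d m W‖ ≤ ‖m‖ * ‖H1.incl d W.1‖ := by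
  rw [kick_apply, Prod.norm_mk, norm_zero, max_eq_right (norm_nonneg _)]
  exact norm_mulL2_le m _

/-- The control operator `controlOp` as a linear function of the control value. -/
def controlL (d : ℕ) :
    (Fin (2 * d + 1) → ℝ) →ₗ[ℝ] ((H1 d × L2 d) →L[ℝ] (H1 d × L2 d)) :=
  (kick d).comp (Fintype.linearCombination ℝ (lowMode d))

theorem isMild_iff_isWeakSolution {τ : ℝ} {p : ℝ → Fin (2 * d + 1) → ℝ}
    {W₀ : H1 d × L2 d} {W : ℝ → H1 d × L2 d} :
    IsMild (freeFlowL d) τ (fun s => controlL d (p s)) W₀ W ↔ IsWeakSolution τ p W₀ W :=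
  ⟨fun h => ⟨h.1, h.2, h.3⟩, fun h => ⟨h.1, h.2, h.3⟩⟩

end Multiplication

section Kickable

variable {d : ℕ} {a b m n : C(Torus d, ℝ)}

/-- The velocity of every state `(w, v)` can be changed approximately by `m w`, keeping the profile,
in arbitrarily small time. -/
def Kickable (m : C(Torus d, ℝ)) : Prop :=
  Impulse (freeFlowL d) (controlL d) (kick d m)

theorem Kickable.add (hm : Kickable m) (hn : Kickable n) : Kickable (m + n) := by
  rw [Kickable, map_add]
  exact Impulse.add hm hn (kick_kick n m)

theorem kickable_potential (p : Fin (2 * d + 1) → ℝ) : Kickable (potential p) :=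
  Impulse.of_control (B := controlL d) (isStrongGroup_freeFlowL d) p (kick_kick _ _)

theorem kickable_zero : Kickable (0 : C(Torus d, ℝ)) := by
  simpa [potential] using kickable_potential (0 : Fin (2 * d + 1) → ℝ)

/-- The functions all of whose real multiples are kickable. -/
def kickSpace (d : ℕ) : Submodule ℝ C(Torus d, ℝ) where
  carrier := {m | ∀ c : ℝ, Kickable (c • m)}
  add_mem' hm hn c := by
    rw [smul_add]
    exact (hm c).add (hn c)
  zero_mem' c := by
    rw [smul_zero]
    exact kickable_zero
  smul_mem' a m hm c := by
    rw [smul_smul]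
    exact hm _

theorem lowMode_mem_kickSpace (j : Fin (2 * d + 1)) : lowMode d j ∈ kickSpace d := by
  intro c
  have hpot : potential (Pi.single j c) = c • lowMode d j :=
    Fintype.linearCombination_apply_single ℝ (lowMode d) j c
  exact hpot ▸ kickable_potential _

theorem one_mem_kickSpace (d : ℕ) : (1 : C(Torus d, ℝ)) ∈ kickSpace d :=
  lowMode_mem_kickSpace (0 : Fin (2 * d + 1))

theorem isClosed_kickSpace (d : ℕ) : IsClosed (kickSpace d : Set C(Torus d, ℝ)) := by
  refine isClosed_of_closure_subset fun m hm c => Impulse.of_approx fun W ε hε => ?_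
  have hcont : Tendsto (fun n : C(Torus d, ℝ) => ‖c • (n - m)‖ * ‖H1.incl d W.1‖) (𝓝 m) (𝓝 0) := by
    have : Continuous fun n : C(Torus d, ℝ) => ‖c • (n - m)‖ * ‖H1.incl d W.1‖ := by fun_prop
    simpa using this.tendsto m
  obtain ⟨n, hnear, hn⟩ := mem_closure_iff_nhds.1 hm _ (hcont.eventually (gt_mem_nhds hε))
  refine ⟨_, hn c, ?_⟩
  rw [← sub_apply, ← map_sub, ← smul_sub]
  exact (norm_kick_le _ W).trans_lt hnear

/-- The continuous functions that are multipliers of `H¹`. -/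
def H1Multiplier (d : ℕ) : Submodule ℝ C(Torus d, ℝ) where
  carrier := {m | ∀ w : H1 d, ∃ g : H1 d, H1.incl d g = mulL2 m (H1.incl d w)}
  add_mem' hm hn w := by
    obtain ⟨g, hg⟩ := hm w
    obtain ⟨g', hg'⟩ := hn w
    exact ⟨g + g', by rw [map_add, hg, hg', mulL2_add_left]⟩
  zero_mem' w := ⟨0, by simpa using (mulL2_smul_left 0 (0 : C(Torus d, ℝ)) (H1.incl d w)).symm⟩
  smul_mem' c m hm w := by
    obtain ⟨g, hg⟩ := hm w
    exact ⟨c • g, by rw [map_smul, hg, mulL2_smul_left]⟩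

theorem kickable_neg_mul_self (hm : m ∈ kickSpace d ⊓ H1Multiplier d) : Kickable (-(m * m)) := by
  rw [Kickable, map_neg]
  refine Impulse.neg_of_tendsto (K := kick d m) (isStrongGroup_freeFlowL d)
    (fun c => by simpa only [Kickable, map_smul] using hm.1 c) (fun W => ?_) (fun W => ?_)
    fun W => ?_
  · obtain ⟨g, hg⟩ := hm.2 W.1
    refine Asymptotics.IsBigO.of_bound ‖g‖ (Eventually.of_forall fun t => ?_)
    rw [kick_apply, ← hg]
    exact (norm_freeFlow_velocity_sub_le t g).trans_eq (mul_comm _ _)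
  · refine Asymptotics.IsBigO.of_bound (‖m‖ * (‖W.1‖ + ‖W.2‖)) (Eventually.of_forall fun t => ?_)
    refine (norm_kick_le m _).trans ?_
    rw [mul_assoc, mul_comm (_ + _)]
    gcongr
    exact norm_incl_freeFlow_fst_sub_le t W
  · have hvel := (tendsto_inv_smul_freeFlow_velocity (mulL2 m (H1.incl d W.1))).mono_left
      (nhdsGT_le_nhdsNE _)
    have hlim := (((ContinuousLinearMap.inr ℝ (H1 d) (L2 d)).comp (mulL m)).continuous.tendsto
      _).comp hvel
    rw [kick_apply (m * m), mulL2_mul]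
    refine hlim.congr fun t => ?_
    simp only [Function.comp_apply, map_smul]
    rfl

theorem kickable_neg_smul_mul_self (hm : m ∈ kickSpace d ⊓ H1Multiplier d) {c : ℝ} (hc : 0 ≤ c) :
    Kickable (-(c • (m * m))) := by
  have := kickable_neg_mul_self ((kickSpace d ⊓ H1Multiplier d).smul_mem (√c) hm)
  rwa [smul_mul_smul_comm, Real.mul_self_sqrt hc] at this

theorem mul_self_mem_kickSpace (ha : a ∈ kickSpace d ⊓ H1Multiplier d)
    (hb : b ∈ kickSpace d ⊓ H1Multiplier d) (hab : a * a + b * b ∈ kickSpace d) :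
    a * a ∈ kickSpace d := by
  intro c
  rcases le_total 0 c with hc | hc
  · have := (hab c).add (kickable_neg_smul_mul_self hb hc)
    rwa [smul_add, add_neg_cancel_right] at this
  · have := kickable_neg_smul_mul_self ha (neg_nonneg.2 hc)
    rwa [neg_smul, neg_neg] at this

/-- Polarization: `±2ab = a² + b² - (a ∓ b)²`, where only the last square needs a sign. -/
theorem mul_mem_kickSpace (ha : a ∈ kickSpace d ⊓ H1Multiplier d)
    (hb : b ∈ kickSpace d ⊓ H1Multiplier d) (haa : a * a ∈ kickSpace d)
    (hbb : b * b ∈ kickSpace d) : a * b ∈ kickSpace d := by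
  intro c
  rcases le_total 0 c with hc | hc
  · have hsq := kickable_neg_smul_mul_self (sub_mem ha hb) (c := c / 2) (by linarith)
    convert! (hsq.add (haa (c / 2))).add (hbb (c / 2)) using 1
    ext x
    simp only [ContinuousMap.add_apply, ContinuousMap.neg_apply, ContinuousMap.smul_apply,
      ContinuousMap.mul_apply, ContinuousMap.sub_apply, smul_eq_mul]
    ring
  · have hsq := kickable_neg_smul_mul_self (add_mem ha hb) (c := -(c / 2)) (by linarith)
    convert! (hsq.add (haa (-(c / 2)))).add (hbb (-(c / 2))) using 1
    ext x
    simp only [ContinuousMap.add_apply, ContinuousMap.neg_apply, ContinuousMap.smul_apply,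
      ContinuousMap.mul_apply, smul_eq_mul]
    ring

end Kickable

/-! ### Every continuous function is kickable -/

section Modes

variable {d : ℕ}

/-- The real part of a continuous function. -/
def rePart (d : ℕ) : C(Torus d, ℂ) →L[ℝ] C(Torus d, ℝ) :=
  Complex.reCLM.compLeftContinuous ℝ (Torus d)

/-- The real trigonometric function `Re (c e^{ilx})`. The phase of `c` interpolates between cosine
(`c = 1`) and sine (`c = -i`), so that both are treated at once. -/
def realMode (c : ℂ) (l : Fin d → ℤ) : C(Torus d, ℝ) := rePart d (c • expMode l)

theorem realMode_apply (c : ℂ) (l : Fin d → ℤ) (x : Torus d) :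
    realMode c l x = (c * expMode l x).re := rfl

theorem realMode_neg (c : ℂ) (l : Fin d → ℤ) :
    realMode c (-l) = realMode ((starRingEnd ℂ) c) l := by
  ext x
  rw [realMode_apply, realMode_apply, ← conj_expMode, ← Complex.conj_re, map_mul, Complex.conj_conj]

theorem realMode_add (c : ℂ) (l l' : Fin d → ℤ) :
    realMode c (l + l')
      = realMode c l * realMode 1 l' - realMode (-Complex.I * c) l * realMode (-Complex.I) l' := by
  ext x
  simp only [realMode_apply, expMode_add, ContinuousMap.sub_apply, ContinuousMap.mul_apply,
    Complex.mul_re, Complex.mul_im, Complex.neg_re, Complex.neg_im, Complex.I_re, Complex.I_im,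
    Complex.one_re, Complex.one_im]
  ring

theorem norm_expMode_apply (k : Fin d → ℤ) (x : Torus d) : ‖expMode k x‖ = 1 := by
  have mul_conj := expMode_mul_conj k k x
  rw [sub_self, expMode_zero, ContinuousMap.one_apply, Complex.mul_conj, Complex.normSq_eq_norm_sq]
    at mul_conj
  exact (pow_eq_one_iff_of_nonneg (norm_nonneg _) two_ne_zero).1 (by exact_mod_cast mul_conj)

theorem realMode_mul_self_add (c : ℂ) (l : Fin d → ℤ) :
    realMode c l * realMode c l + realMode (-Complex.I * c) l * realMode (-Complex.I * c) l
      = (‖c‖ ^ 2) • (1 : C(Torus d, ℝ)) := by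
  ext x
  have norm_sq : ‖c * expMode l x‖ ^ 2 = ‖c‖ ^ 2 := by rw [norm_mul, norm_expMode_apply, mul_one]
  rw [← Complex.normSq_eq_norm_sq, Complex.normSq_apply] at norm_sq
  simp only [realMode_apply, mul_assoc, ContinuousMap.add_apply, ContinuousMap.mul_apply,
    ContinuousMap.smul_apply, ContinuousMap.one_apply, smul_eq_mul, mul_one, ← norm_sq,
    Complex.neg_re, Complex.I_mul_re, neg_neg, neg_mul]

theorem coeff_mulL2 (m : C(Torus d, ℝ)) (w : L2 d) (k : Fin d → ℤ) :
    coeff (mulL2 m w) k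
      = ∫ x, ((m x : ℝ) : ℂ) * (((w x : ℝ) : ℂ) * (starRingEnd ℂ) (phi k x)) := by
  refine integral_congr_ae ?_
  filter_upwards [coeFn_mulL2 m w] with x hx
  rw [hx, Complex.ofReal_mul, mul_assoc]

theorem expMode_mul_conj_phi (l k : Fin d → ℤ) (x : Torus d) :
    expMode l x * (starRingEnd ℂ) (phi k x) = (starRingEnd ℂ) (phi (k - l) x) := by
  rw [conj_phi, conj_phi, expMode_mul_phi, neg_sub, sub_eq_add_neg]

theorem coeff_mulL2_realMode (c : ℂ) (l : Fin d → ℤ) (w : L2 d) (k : Fin d → ℤ) :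
    coeff (mulL2 (realMode c l) w) k
      = c / 2 * coeff w (k - l) + (starRingEnd ℂ) c / 2 * coeff w (k + l) := by
  rw [coeff_mulL2, coeff, coeff, ← integral_const_mul, ← integral_const_mul,
    ← integral_add ((integrable_mul_mode w _).const_mul _)
      ((integrable_mul_mode w _).const_mul _)]
  congr 1
  ext x
  rw [← sub_neg_eq_add k l, ← expMode_mul_conj_phi l, ← expMode_mul_conj_phi (-l), realMode_apply,
    Complex.re_eq_add_conj, map_mul, conj_expMode]
  ring

theorem one_add_eigen_le (k l : Fin d → ℤ) :
    1 + eigen k ≤ 2 * (1 + eigen l) * (1 + eigen (k - l)) := by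
  have triangle : eigen k ≤ 2 * eigen l + 2 * eigen (k - l) := by
    simp only [eigen, Finset.mul_sum, ← Finset.sum_add_distrib, ← mul_add]
    refine Finset.sum_le_sum fun i _ => ?_
    simpa using add_sq_le (a := (l i : ℝ)) (b := ((k - l) i : ℤ))
  nlinarith [eigen_nonneg l, eigen_nonneg (k - l),
    mul_nonneg (eigen_nonneg l) (eigen_nonneg (k - l))]

theorem summable_one_add_eigen_mul_norm_coeff_sub_sq (w : H1 d) (l : Fin d → ℤ) :
    Summable fun k => (1 + eigen k) * ‖coeff (H1.incl d w) (k - l)‖ ^ 2 := by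
  have shifted := ((Equiv.subRight l).summable_iff.2 (H1.hasSum_norm_sq w).summable).mul_left
    (2 * (1 + eigen l))
  refine shifted.of_nonneg_of_le
    (fun k => mul_nonneg (one_add_eigen_pos k).le (sq_nonneg _)) fun k => ?_
  rw [Function.comp_apply, Equiv.subRight_apply, ← mul_assoc]
  exact mul_le_mul_of_nonneg_right (one_add_eigen_le k l) (sq_nonneg _)

theorem realMode_mem_H1Multiplier (c : ℂ) (l : Fin d → ℤ) : realMode c l ∈ H1Multiplier d := by
  intro w
  refine ⟨H1.mk (mulL2 (realMode c l) (H1.incl d w)) ?_, rfl⟩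
  have summable_sum := (summable_one_add_eigen_mul_norm_coeff_sub_sq w l).add
    (summable_one_add_eigen_mul_norm_coeff_sub_sq w (-l))
  refine (summable_sum.mul_left (‖c‖ ^ 2 / 2)).of_nonneg_of_le
    (fun k => mul_nonneg (eigen_nonneg k) (sq_nonneg _)) fun k => ?_
  rw [coeff_mulL2_realMode, sub_neg_eq_add]
  set x := coeff (H1.incl d w) (k - l)
  set y := coeff (H1.incl d w) (k + l)
  have norm_le : ‖c / 2 * x + (starRingEnd ℂ) c / 2 * y‖ ≤ ‖c‖ / 2 * (‖x‖ + ‖y‖) := by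
    refine (norm_add_le _ _).trans_eq ?_
    simp only [norm_mul, norm_div, RCLike.norm_conj, Complex.norm_ofNat]
    ring
  calc eigen k * ‖c / 2 * x + (starRingEnd ℂ) c / 2 * y‖ ^ 2
      ≤ (1 + eigen k) * ((‖c‖ / 2) ^ 2 * (2 * (‖x‖ ^ 2 + ‖y‖ ^ 2))) := by
        have := eigen_nonneg k
        gcongr
        · linarith
        · exact (pow_le_pow_left₀ (norm_nonneg _) norm_le 2).trans
            (by rw [mul_pow]; gcongr; exact add_sq_le)
    _ = ‖c‖ ^ 2 / 2 * ((1 + eigen k) * ‖x‖ ^ 2 + (1 + eigen k) * ‖y‖ ^ 2) := by ring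

end Modes

section Saturation

variable {d : ℕ}

theorem realMode_mul_realMode_mem_kickSpace {l l' : Fin d → ℤ}
    (hl : ∀ c, realMode c l ∈ kickSpace d) (hl' : ∀ c, realMode c l' ∈ kickSpace d) (c c' : ℂ) :
    realMode c l * realMode c' l' ∈ kickSpace d := by
  have sq_mem {k : Fin d → ℤ} (hk : ∀ c, realMode c k ∈ kickSpace d) (c : ℂ) :
      realMode c k * realMode c k ∈ kickSpace d := by
    refine mul_self_mem_kickSpace ⟨hk c, realMode_mem_H1Multiplier c k⟩
      ⟨hk (-Complex.I * c), realMode_mem_H1Multiplier _ k⟩ ?_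
    rw [realMode_mul_self_add]
    exact (kickSpace d).smul_mem _ (one_mem_kickSpace d)
  exact mul_mem_kickSpace ⟨hl c, realMode_mem_H1Multiplier c l⟩
    ⟨hl' c', realMode_mem_H1Multiplier c' l'⟩ (sq_mem hl c) (sq_mem hl' c')

/-- The frequencies all of whose real modes are kickable. -/
def kickFrequencies (d : ℕ) : AddSubgroup (Fin d → ℤ) where
  carrier := {l | ∀ c, realMode c l ∈ kickSpace d}
  zero_mem' c := by
    have const : realMode c (0 : Fin d → ℤ) = c.re • 1 := by
      ext x
      simp [realMode_apply, expMode_zero]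
    exact const ▸ (kickSpace d).smul_mem _ (one_mem_kickSpace d)
  neg_mem' hl c := realMode_neg c _ ▸ hl _
  add_mem' hl hl' c := realMode_add c _ _ ▸ sub_mem
    (realMode_mul_realMode_mem_kickSpace hl hl' _ _)
    (realMode_mul_realMode_mem_kickSpace hl hl' _ _)

theorem single_mem_kickFrequencies (i : Fin d) : Pi.single i 1 ∈ kickFrequencies d := by
  intro c
  have decomposition : realMode c (Pi.single i 1)
      = c.re • lowMode d ⟨2 * i + 1, by omega⟩ - c.im • lowMode d ⟨2 * i + 2, by omega⟩ := by
    have index : (⟨(2 * i + 1) / 2, by omega⟩ : Fin d) = i := Fin.ext (by grind)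
    ext x
    rw [realMode_apply, expMode_single, Complex.mul_re]
    simp [lowMode, index]
  rw [decomposition]
  exact sub_mem ((kickSpace d).smul_mem _ (lowMode_mem_kickSpace _))
    ((kickSpace d).smul_mem _ (lowMode_mem_kickSpace _))

theorem realMode_mem_kickSpace (c : ℂ) (l : Fin d → ℤ) : realMode c l ∈ kickSpace d := by
  suffices l ∈ kickFrequencies d from this c
  rw [← Finset.univ_sum_single l]
  refine sum_mem fun i _ => ?_
  have := zsmul_mem (single_mem_kickFrequencies i) (l i)
  rwa [← Pi.single_smul, smul_eq_mul, mul_one] at this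

theorem rePart_mem_kickSpace (F : C(Torus d, ℂ)) : rePart d F ∈ kickSpace d := by
  have mapsTo_span : MapsTo (rePart d) (Submodule.span ℂ (range (expMode (d := d))))
      (kickSpace d : Set C(Torus d, ℝ)) := by
    intro G hG
    obtain ⟨a, rfl⟩ := Finsupp.mem_span_range_iff_exists_finsupp.1 hG
    rw [Finsupp.sum, map_sum]
    exact sum_mem fun l _ => realMode_mem_kickSpace (a l) l
  have mem_closure : F ∈ (Submodule.span ℂ (range (expMode (d := d)))).topologicalClosure :=
    topologicalClosure_span_expMode d ▸ Submodule.mem_top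
  exact (isClosed_kickSpace d).closure_subset
    (map_mem_closure (rePart d).continuous mem_closure mapsTo_span)

theorem kickable (m : C(Torus d, ℝ)) : Kickable m := by
  have := rePart_mem_kickSpace ((⟨Complex.ofReal, Complex.continuous_ofReal⟩ : C(ℝ, ℂ)).comp m) 1
  rwa [one_smul] at this

end Saturation

/-! ### Multiples of a nowhere vanishing function -/

section Density

variable {α : Type*} [MeasurableSpace α] {μ : Measure α} {p : ℝ≥0∞} {w : α → ℝ}

theorem eLpNorm_withDensity_enorm_rpow (hw : AEStronglyMeasurable w μ) (hp₀ : p ≠ 0) (hp : p ≠ ∞)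
    (g : α → ℝ) :
    eLpNorm g p (μ.withDensity fun x => ‖w x‖ₑ ^ p.toReal) = eLpNorm (fun x => g x * w x) p μ := by
  rw [eLpNorm_eq_lintegral_rpow_enorm_toReal hp₀ hp, eLpNorm_eq_lintegral_rpow_enorm_toReal hp₀ hp,
    lintegral_withDensity_eq_lintegral_mul_non_measurable₀ μ (hw.enorm.pow_const _)
      (Eventually.of_forall fun x => ENNReal.rpow_lt_top_of_nonneg ENNReal.toReal_nonneg
        enorm_ne_top)]
  congr 2
  ext x
  rw [Pi.mul_apply, enorm_mul, ENNReal.mul_rpow_of_nonneg _ _ ENNReal.toReal_nonneg, mul_comm]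

variable [TopologicalSpace α] [TopologicalSpace.PseudoMetrizableSpace α] [BorelSpace α]

open scoped BoundedContinuousFunction in
/-- Approximate the quotient `f / w` in `L^p` of the finite measure `|w|^p μ`. -/
theorem exists_boundedContinuous_eLpNorm_mul_sub_le {f : α → ℝ} (hp₀ : p ≠ 0) (hp : p ≠ ∞)
    (hw : MemLp w p μ) (hw₀ : ∀ᵐ x ∂μ, w x ≠ 0) (hf : MemLp f p μ) {ε : ℝ≥0∞} (hε : ε ≠ 0) :
    ∃ m : α →ᵇ ℝ, eLpNorm (fun x => m x * w x - f x) p μ ≤ ε := by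
  set ν := μ.withDensity fun x => ‖w x‖ₑ ^ p.toReal
  have : IsFiniteMeasure ν :=
    isFiniteMeasure_withDensity (lintegral_rpow_enorm_lt_top_of_eLpNorm_lt_top hp₀ hp hw.2).ne
  have norm_eq := eLpNorm_withDensity_enorm_rpow hw.1 hp₀ hp
  have quotient_memLp : MemLp (fun x => f x / w x) p ν := by
    refine ⟨(hf.1.div₀ hw.1).mono_ac (withDensity_absolutelyContinuous μ _), ?_⟩
    rw [norm_eq, eLpNorm_congr_ae (hw₀.mono fun x hx => div_mul_cancel₀ (f x) hx)]
    exact hf.2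
  obtain ⟨m, hm, -⟩ := quotient_memLp.exists_boundedContinuous_eLpNorm_sub_le hp hε
  refine ⟨m, le_of_eq_of_le ?_ hm⟩
  rw [eLpNorm_sub_comm, norm_eq]
  refine eLpNorm_congr_ae (hw₀.mono fun x hx => ?_)
  simp only [Pi.sub_apply, sub_mul, div_mul_cancel₀ _ hx]

end Density

section Velocity

variable {d : ℕ}

theorem exists_norm_mulL2_sub_lt {w : L2 d} (hw : ∀ᵐ x, w x ≠ 0) (f : L2 d) {ε : ℝ} (hε : 0 < ε) :
    ∃ m : C(Torus d, ℝ), ‖mulL2 m w - f‖ < ε := by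
  obtain ⟨m, hm⟩ := exists_boundedContinuous_eLpNorm_mul_sub_le two_ne_zero ENNReal.ofNat_ne_top
    (Lp.memLp w) hw (Lp.memLp f) (ENNReal.ofReal_pos.2 (half_pos hε)).ne'
  refine ⟨m.toContinuousMap, lt_of_le_of_lt ?_ (half_lt_self hε)⟩
  rw [Lp.norm_def]
  refine ENNReal.toReal_le_of_le_ofReal (half_pos hε).le (le_of_eq_of_le (eLpNorm_congr_ae ?_) hm)
  filter_upwards [Lp.coeFn_sub (mulL2 m.toContinuousMap w) f, coeFn_mulL2 m.toContinuousMap w]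
    with x hsub hmul
  rw [hsub, Pi.sub_apply, hmul]
  rfl

theorem reachIn_velocity {w : H1 d} (hw : ∀ᵐ x, H1.incl d w x ≠ 0) (v f : L2 d) {T : ℝ}
    (hT : 0 < T) : ReachIn (freeFlowL d) (controlL d) T (w, v) (w, f) := by
  refine ReachIn.of_approx fun ε hε => ?_
  obtain ⟨m, hm⟩ := exists_norm_mulL2_sub_lt hw (f - v) hε
  refine ⟨_, kickable m T hT (w, v), ?_⟩
  rwa [kick_apply, Prod.mk_add_mk, add_zero, Prod.mk_sub_mk, sub_self, Prod.norm_mk, norm_zero,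
    max_eq_right (norm_nonneg _), add_comm v, ← sub_sub_eq_add_sub]

end Velocity

/-! ### Zeros of trigonometric polynomials -/

section TrigonometricPolynomials

/-- The character `s ↦ e^{iωs}` of the real line. -/
def expChar (ω : ℝ) : Multiplicative ℝ →* ℂ where
  toFun s := Complex.exp (((s.toAdd * ω : ℝ) : ℂ) * Complex.I)
  map_one' := by simp
  map_mul' s t := by
    rw [← Complex.exp_add, toAdd_mul, add_mul, Complex.ofReal_add, add_mul]

theorem expChar_injective : Function.Injective expChar := by
  intro a b hab
  by_contra hne
  have shift : π / (a - b) * a = π / (a - b) * b + π := by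
    field_simp [sub_ne_zero.2 hne]
    ring
  have antiperiodic := DFunLike.congr_fun hab (Multiplicative.ofAdd (π / (a - b)))
  simp only [expChar, MonoidHom.coe_mk, OneHom.coe_mk, toAdd_ofAdd] at antiperiodic
  rw [shift, Complex.ofReal_add, add_mul, Complex.exp_add, Complex.exp_pi_mul_I, mul_neg_one,
    neg_eq_self] at antiperiodic
  exact Complex.exp_ne_zero _ antiperiodic

variable {ι : Type*} {S : Finset ι} {ω : ι → ℝ} {a : ι → ℂ}

theorem exists_sum_mul_expChar_ne_zero (hS : S.Nonempty) (hω : InjOn ω S)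
    (ha : ∀ k ∈ S, a k ≠ 0) : ∃ s, ∑ k ∈ S, a k * expChar (ω k) s ≠ 0 := by
  by_contra! vanishes
  have independent := (linearIndependent_monoidHom (Multiplicative ℝ) ℂ).comp
    (fun k : S => expChar (ω k)) fun k l hkl => Subtype.ext (hω k.2 l.2 (expChar_injective hkl))
  obtain ⟨k, hk⟩ := hS
  refine ha k hk (Fintype.linearIndependent_iff.1 independent (fun k => a k) ?_ ⟨k, hk⟩)
  funext s
  simp only [Finset.sum_apply, Pi.smul_apply, Function.comp_apply, smul_eq_mul, Pi.zero_apply]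
  exact (Finset.sum_coe_sort S fun k => a k * expChar (ω k) s).trans (vanishes s)

theorem volume_zeros_sum_mul_exp (hS : S.Nonempty) (hω : InjOn ω S) (ha : ∀ k ∈ S, a k ≠ 0) :
    volume {s : ℝ | ∑ k ∈ S, a k * Complex.exp (((s * ω k : ℝ) : ℂ) * Complex.I) = 0} = 0 := by
  set F : ℝ → ℂ := fun s => ∑ k ∈ S, a k * Complex.exp (((s * ω k : ℝ) : ℂ) * Complex.I)
  have analytic : AnalyticOnNhd ℝ F univ := fun s _ =>
    Finset.analyticAt_fun_sum _ fun k _ => analyticAt_const.mul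
      ((analyticAt_cexp.restrictScalars (𝕜 := ℝ)).comp
        (((Complex.ofRealCLM.analyticAt _).comp (analyticAt_id.mul analyticAt_const)).mul
          analyticAt_const))
  obtain ⟨s, hs⟩ := exists_sum_mul_expChar_ne_zero hS hω ha
  have codiscrete := analytic.preimage_zero_mem_codiscrete (x := s.toAdd) hs
  have nonzero_ae := ae_restrict_le_codiscreteWithin (μ := volume) MeasurableSet.univ codiscrete
  rw [Measure.restrict_univ, mem_ae_iff] at nonzero_ae
  exact measure_mono_null (fun s hs (hn : F s ≠ 0) => hn hs) nonzero_ae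

variable {d : ℕ}

theorem expMode_add_line (k : Fin d → ℤ) (x : Torus d) (θ : Fin d → ℝ) (s : ℝ) :
    expMode k (x + fun i => ((s * θ i : ℝ) : AddCircle (2 * π)))
      = expMode k x * Complex.exp (((s * ∑ i, k i * θ i : ℝ) : ℂ) * Complex.I) := by
  have factor (i : Fin d) :
      fourier (k i) ((x + fun i => ((s * θ i : ℝ) : AddCircle (2 * π))) i)
        = fourier (k i) (x i) * Complex.exp (((s * (k i * θ i) : ℝ) : ℂ) * Complex.I) := by
    rw [Pi.add_apply, fourier_apply, smul_add, AddCircle.toCircle_add, Circle.coe_mul,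
      ← fourier_apply, ← fourier_apply, fourier_coe_apply]
    congr 2
    have : (π : ℂ) ≠ 0 := Complex.ofReal_ne_zero.2 Real.pi_ne_zero
    push_cast
    field_simp
  simp only [expMode, ContinuousMap.coe_mk, factor, Finset.prod_mul_distrib, ← Complex.exp_sum,
    ← Finset.sum_mul, ← Complex.ofReal_sum, ← Finset.mul_sum]

theorem exists_injOn_sum_mul (S : Finset (Fin d → ℤ)) :
    ∃ θ : Fin d → ℝ, InjOn (fun k : Fin d → ℤ => ∑ i, (k i : ℝ) * θ i) S := by
  let difference : {q : S × S // q.1 ≠ q.2} → (Fin d → ℝ) := fun q i => q.1.1.1 i - q.1.2.1 i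
  have difference_ne_zero (q) : difference q ≠ 0 := fun h =>
    q.2 (Subtype.ext (funext fun i => by simpa [difference, sub_eq_zero] using congrFun h i))
  obtain ⟨f, hf⟩ := Module.exists_dual_forall_apply_ne_zero (K := ℝ) difference difference_ne_zero
  refine ⟨fun i => f (Pi.single i 1), fun k hk l hl hkl => by_contra fun hne => ?_⟩
  refine hf ⟨(⟨k, hk⟩, ⟨l, hl⟩), fun h => hne (congrArg Subtype.val h)⟩ ?_
  rw [LinearMap.pi_apply_eq_sum_univ f]
  refine Eq.trans (Finset.sum_congr rfl fun i _ => ?_)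
    ((Finset.sum_sub_distrib ..).trans (sub_eq_zero.2 hkl))
  rw [← sub_mul, smul_eq_mul]
  congr 2
  ext j
  simp [Pi.single_apply, eq_comm]

/-- Along every line in a direction that separates the frequencies, the polynomial is a nontrivial
combination of distinct exponentials, so that Fubini's theorem reduces the claim to one variable. -/
theorem volume_zeros_sum_mul_expMode {S : Finset (Fin d → ℤ)} (hS : S.Nonempty)
    {a : (Fin d → ℤ) → ℂ} (ha : ∀ k ∈ S, a k ≠ 0) :
    volume {x : Torus d | ∑ k ∈ S, a k * expMode k x = 0} = 0 := by
  obtain ⟨θ, hθ⟩ := exists_injOn_sum_mul S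
  set Z : Set (Torus d) := {x | ∑ k ∈ S, a k * expMode k x = 0}
  have isClosed_Z : IsClosed Z := isClosed_eq (by fun_prop) continuous_const
  let γ : ℝ → Torus d := fun s i => ((s * θ i : ℝ) : AddCircle (2 * π))
  have continuous_γ : Continuous γ := continuous_pi fun i =>
    (AddCircle.continuous_mk' _).comp (continuous_id.mul continuous_const)
  let N : Set (Torus d × ℝ) := {q | q.1 + γ q.2 ∈ Z}
  have measurableSet_N : MeasurableSet N :=
    (isClosed_Z.preimage (continuous_fst.add (continuous_γ.comp continuous_snd))).measurableSet
  have null : (volume.prod volume : Measure (Torus d × ℝ)) N = 0 := by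
    rw [Measure.measure_prod_null measurableSet_N]
    refine Eventually.of_forall fun x => ?_
    have := volume_zeros_sum_mul_exp hS hθ (a := fun k => a k * expMode k x) fun k hk =>
      mul_ne_zero (ha k hk) (norm_ne_zero_iff.1 (norm_expMode_apply k x ▸ one_ne_zero))
    simpa only [mul_assoc, ← expMode_add_line] using! this
  have slice (s : ℝ) : volume ((fun x => (x, s)) ⁻¹' N) = volume Z :=
    measure_preimage_add_right volume (γ s) Z
  rw [Measure.prod_apply_symm measurableSet_N] at null
  simpa [slice] using null

theorem toComplex_eq_sum {w : L2 d} (hw : {k | coeff w k ≠ 0}.Finite) :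
    toComplex w = ∑ k ∈ hw.toFinset, coeff w k • phiLp k := by
  have expansion := (phiBasis d).hasSum_repr (toComplex w)
  simp only [phiBasis_repr_toComplex, coe_phiBasis] at expansion
  exact expansion.unique (hasSum_sum_of_ne_finset_zero fun k hk => by
    rw [not_not.1 (mt hw.mem_toFinset.2 hk), zero_smul])

theorem ae_ofReal_eq_sum {w : L2 d} (hw : {k | coeff w k ≠ 0}.Finite) :
    ∀ᵐ x, ((w x : ℝ) : ℂ) = ∑ k ∈ hw.toFinset, coeff w k * phi k x := by
  have := coeFn_toComplex w
  rw [toComplex_eq_sum hw] at this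
  filter_upwards [this, Lp.coeFn_finsetSum hw.toFinset fun k => coeff w k • phiLp k,
    ae_all_iff.2 fun k => Lp.coeFn_smul (coeff w k) (phiLp k), ae_all_iff.2 coeFn_phiLp]
    with x hx hsum hsmul hphi
  simp only [← hx, hsum, hsmul, hphi, Finset.sum_apply, Pi.smul_apply, smul_eq_mul]

theorem ae_ne_zero_of_finite_coeff {w : L2 d} (hw : {k | coeff w k ≠ 0}.Finite) (hw₀ : w ≠ 0) :
    ∀ᵐ x, w x ≠ 0 := by
  have nonempty : hw.toFinset.Nonempty := by
    contrapose! hw₀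
    refine ext_coeff fun k => ?_
    rw [coeff_zero]
    by_contra hk
    exact Finset.eq_empty_iff_forall_notMem.1 hw₀ k (hw.mem_toFinset.2 hk)
  have nonzero := volume_zeros_sum_mul_expMode nonempty fun k hk => hw.mem_toFinset.1 hk
  filter_upwards [ae_ofReal_eq_sum hw, measure_eq_zero_iff_ae_notMem.1 nonzero] with x hx hne hzero
  refine hne ?_
  simp only [hzero, phi_apply, mul_left_comm (coeff w _), ← Finset.mul_sum] at hx
  exact (mul_eq_zero.1 hx.symm).resolve_left
    (Complex.ofReal_ne_zero.2 (Real.rpow_pos_of_pos Real.two_pi_pos _).ne')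

end TrigonometricPolynomials

end

end BilinearWave

theorem mainTheorem4_general (d : ℕ) (w₀ : BilinearWave.H1 d) (v₀ f : BilinearWave.L2 d)
    (hw₀ : ∀ᵐ x, BilinearWave.H1.incl d w₀ x ≠ 0) (ε T : ℝ) (hε : 0 < ε) (hT : 0 < T) :
    ∃ τ ∈ Set.Ico 0 T, ∃ p : ℝ → Fin (2 * d + 1) → ℝ,
      BilinearWave.IsPiecewiseConstant τ p ∧
      (∃ W, BilinearWave.IsWeakSolution τ p (w₀, v₀) W) ∧
      ∀ W, BilinearWave.IsWeakSolution τ p (w₀, v₀) W →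
        √(‖(W τ).1 - w₀‖ ^ 2 + ‖(W τ).2 - f‖ ^ 2) < ε := by
  obtain ⟨τ, hτT, L, hL, hclose⟩ :=
    BilinearWave.reachIn_velocity hw₀ v₀ f (half_pos hT) (ε / 2) (half_pos hε)
  have hS := BilinearWave.isStrongGroup_freeFlowL d
  obtain ⟨p, hp, ⟨C, hC⟩, hsol⟩ := hL.exists_control hS
  obtain ⟨W₁, hW₁, hLW⟩ := hsol (w₀, v₀)
  refine ⟨τ, ⟨hL.nonneg, by linarith⟩, p, hp,
    ⟨W₁, BilinearWave.isMild_iff_isWeakSolution.1 hW₁⟩, fun W hW => ?_⟩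
  have hWL : W τ = L (w₀, v₀) :=
    ((BilinearWave.isMild_iff_isWeakSolution.2 hW).unique hS (fun s _ => hC s) hW₁
      (right_mem_Icc.2 hL.nonneg)).trans hLW
  rw [← hWL] at hclose
  have hprofile : ‖(W τ).1 - w₀‖ < ε / 2 := (norm_fst_le (W τ - (w₀, f))).trans_lt hclose
  have hvelocity : ‖(W τ).2 - f‖ < ε / 2 := (norm_snd_le (W τ - (w₀, f))).trans_lt hclose
  rw [Real.sqrt_lt' hε]
  nlinarith [norm_nonneg ((W τ).1 - w₀), norm_nonneg ((W τ).2 - f)]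

theorem mainTheorem4 (d : ℕ) (w₀ : BilinearWave.H1 d) (v₀ f : BilinearWave.L2 d)
    (hw₀ : w₀ ≠ 0)
    (hfin : {k : Fin d → ℤ | BilinearWave.coeff (BilinearWave.H1.incl d w₀) k ≠ 0}.Finite)
    (ε T : ℝ) (hε : 0 < ε) (hT : 0 < T) :
    ∃ τ ∈ Set.Ico 0 T, ∃ p : ℝ → Fin (2 * d + 1) → ℝ,
      BilinearWave.IsPiecewiseConstant τ p ∧
      (∃ W, BilinearWave.IsWeakSolution τ p (w₀, v₀) W) ∧
      ∀ W, BilinearWave.IsWeakSolution τ p (w₀, v₀) W →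
        √(‖(W τ).1 - w₀‖ ^ 2 + ‖(W τ).2 - f‖ ^ 2) < ε :=
  mainTheorem4_general d w₀ v₀ f (BilinearWave.ae_ne_zero_of_finite_coeff hfin
    fun h => hw₀ (BilinearWave.H1.incl_injective d (h.trans (map_zero _).symm))) ε T hε hT
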